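/- Let $k$ be a field of characteristic $\neq 2$, let $l\ge 1$, and let $n=2l$ or $n=2l+1$. Index rows and columns by $1,\dots,l,-1,\dots,-l$ if $n=2l$ and by $0,1,\dots,l,-1,\dots,-l$ if $n=2l+1$. Let $$\beta=\begin{pmatrix}0&I_l\\ I_l&0\end{pmatrix}\ (n=2l),\qquad \beta=\begin{pmatrix}2&0&0\\0&0&I_l\\0&I_l&0\end{pmatrix}\ (n=2l+1),$$ and $\mathrm O(n,k)=\{g\in \mathrm{GL}(n,k)\mid {}^tg\beta g=\beta\}$, $\mathrm{SO}(n,k)=\{g\in\mathrm O(n,k)\mid\det g=1\}$. For $u\in k^n$ with $\beta(u,u)={}^tu\beta u\ne0$ let $\rho_u(v)=v-2\frac{\beta(u,v)}{\beta(u,u)}u$. The *spinor norm* of $g\in\mathrm O(n,k)$ is $\Theta(g)=\prod_{i}\frac12\beta(u_i,u_i)\cdot k^{\times2}\in k^\times/k^{\times 2}$, where $g=\rho_{u_1}\cdots\rho_{u_m}$. *Elementary matrices.* For $1\le i,j\le l$ and $t\in k$ put $x_{i,j}(t)=I+t(e_{i,j}-e_{-j,-i})$ for $i\ne j$; $x_{i,-j}(t)=I+t(e_{i,-j}-e_{j,-i})$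 and $x_{-i,j}(t)=I+t(e_{-i,j}-e_{-j,i})$ for $i<j$; $w_l=I-e_{l,l}-e_{-l,-l}-e_{l,-l}-e_{-l,l}$; and, for $n=2l+1$ only, $x_{i,0}(t)=I+t(2e_{i,0}-e_{0,-i})-t^2e_{i,-i}$ and $x_{0,i}(t)=I+t(-2e_{-i,0}+e_{0,i})-t^2e_{-i,i}$. Left (right) multiplication by such matrices gives the row (column) operations of type 1 ($x_{i,j}$), type 2 ($x_{i,-j}$), type 3 ($x_{-i,j}$) and type 4 ($x_{i,0}$, $x_{0,i}$). *Elimination algorithm.* In a matrix let $A$ be the block with rows and columns $1,\dots,l$; $B$ the block with rows $1,\dots,l$ and columns $-1,\dots,-l$; $C$ the block with rows $-1,\dots,-l$ and columns $1,\dots,l$; and, for $n=2l+1$, let $X$ be row $0$, columns $1,\dots,l$, and $E$ column $0$, rows $1,\dots,l$. To *interchange* $i$ and $-i$ means to multiply on the left by $I-e_{i,i}-e_{-i,-i}-e_{i,-i}-e_{-i,i}$ if $n=2l$, and by $I-2e_{0,0}-e_{i,i}-e_{-i,-i}-e_{i,-i}-e_{-i,i}$ if $n=2l+1$. Starting from $g\in\mathrm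 O(n,k)$: 1. By row and column operations of type 1 bring $A$ to the form (a) $\mathrm{diag}(1,\dots,1,\lambda)$ with $\lambda\ne0$, or (b) $\mathrm{diag}(1,\dots,1,0,\dots,0)$ with $m<l$ ones. 2. If $n=2l+1$, by row and column operations of type 4 make $X=0=E$ in case (a), and make the first $m$ entries of $X$ and of $E$ zero in case (b), keeping the form of $A$. 3. By row operations of type 3 make $C=0$ in case (a), and make the upper left $m\times m$ block of $C$ zero in case (b). 4. In case (b), interchange $i$ and $-i$ for each $m<i\le l$, then bring $A$ to the form $\mathrm{diag}(1,\dots,1,\lambda)$, $\lambda\neq0$, by row and column operations of type 1, and, if $n=2l+1$, make $X=0=E$ by row and column operations of type 4. In both cases the matrix is now $\begin{pmatrix}A&B\\0&A^{-1}\end{pmatrix}$ if $n=2l$, and $\begin{pmatrix}\alpha&0&0\\0&A&B\\0&0&A^{-1}\end{pmatrix}$ if $n=2l+1$, with $A=\mathrm{diag}(1,\dots,1,\lambda)$. 5. By row operations of type 2 make $B=0$. The result is $\mathrm{diag}(1,\dots,1,\lambda,1,\dots,1,\lambda^{-1})$ if $n=2l$, and $\mathrm{diag}(\alpha,1,\dots,1,\lambda,1,\dots,1,\lambda^{-1})$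 if $n=2l+1$. The algorithm outputs $\lambda\in k^\times$. Then the following holds for every $g\in\mathrm O(n,k)$. - $g$ is a product of reflections, and $\Theta(g)$ does not depend on the product chosen. - The elimination algorithm can be carried out on $g$. - Whatever operations are chosen, the entry $\lambda$ that the algorithm outputs satisfies $\Theta(g)=\lambda k^{\times2}$. If moreover $g\in\mathrm{SO}(n,k)$, then $g$ lies in the commutator subgroup $[\mathrm O(n,k),\mathrm O(n,k)]$ if and only if $\lambda$ is a square in $k$. - The same two assertions hold for every $\lambda\in k^\times$ such that some finite sequence of row and column operations by elementary matrices, in any order, turns $g$ into $\mathrm{diag}(1,\dots,1,\lambda,1,\dots,1,\lambda^{-1})$ if $n=2l$, or into $\mathrm{diag}(\alpha,1,\dots,1,\lambda,1,\dots,1,\lambda^{-1})$ for some $\alpha\in k$ if $n=2l+1$. -/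

import Mathlib

open Matrix

namespace SplitOrth

noncomputable section

/-! ### Orthogonal groups and the spinor norm of a symmetric matrix -/

section General

variable {ι k : Type*} [Fintype ι] [DecidableEq ι] [Field k]

/-- The value `β(u, v) = ᵗu β v` of the bilinear form with matrix `β`. -/
def bil (β : Matrix ι ι k) (u v : ι → k) : k := u ⬝ᵥ (β *ᵥ v)

/-- The orthogonal group `{g ∈ GL | ᵗg β g = β}` of the form with matrix `β`. -/
def orthGroup (β : Matrix ι ι k) : Subgroup (GL ι k) where
  carrier := {g | (g : Matrix ι ι k)ᵀ * β * (g : Matrix ι ι k) = β}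
  one_mem' := by simp
  mul_mem' := by
    intro a b ha hb
    simp only [Set.mem_ofPred_eq] at ha hb ⊢
    calc _ = (b : Matrix ι ι k)ᵀ * ((a : Matrix ι ι k)ᵀ * β * (a : Matrix ι ι k))
              * (b : Matrix ι ι k) := by
            simp only [Units.val_mul, Matrix.transpose_mul, Matrix.mul_assoc]
      _ = β := by rw [ha, hb]
  inv_mem' := by
    intro a ha
    simp only [Set.mem_ofPred_eq] at ha ⊢
    have h1 : (a : Matrix ι ι k) * ((a⁻¹ : GL ι k) : Matrix ι ι k) = 1 := a.mul_inv
    have h2 : ((a⁻¹ : GL ι k) : Matrix ι ι k)ᵀ * (a : Matrix ι ι k)ᵀ = 1 := by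
      rw [← Matrix.transpose_mul, h1, Matrix.transpose_one]
    calc ((a⁻¹ : GL ι k) : Matrix ι ι k)ᵀ * β * ((a⁻¹ : GL ι k) : Matrix ι ι k)
        = ((a⁻¹ : GL ι k) : Matrix ι ι k)ᵀ * ((a : Matrix ι ι k)ᵀ * β * (a : Matrix ι ι k))
            * ((a⁻¹ : GL ι k) : Matrix ι ι k) := by rw [ha]
      _ = (((a⁻¹ : GL ι k) : Matrix ι ι k)ᵀ * (a : Matrix ι ι k)ᵀ) * β *
            ((a : Matrix ι ι k) * ((a⁻¹ : GL ι k) : Matrix ι ι k)) := by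
            simp only [Matrix.mul_assoc]
      _ = β := by rw [h1, h2, Matrix.one_mul, Matrix.mul_one]

/-- The underlying matrix of an element of the orthogonal group. -/
def toMat {β : Matrix ι ι k} (g : orthGroup β) : Matrix ι ι k := ((g : GL ι k) : Matrix ι ι k)

/-- The matrix of the reflection `ρ_u : v ↦ v - 2 (β(u, v) / β(u, u)) u`
in the hyperplane orthogonal to `u` (meaningful for `β(u, u) ≠ 0`). -/
def refl (β : Matrix ι ι k) (u : ι → k) : Matrix ι ι k :=
  1 - (2 / bil β u u) • vecMulVec u (u ᵥ* β)

/-- `g = ρ_{u₁} ⋯ ρ_{u_m}` with all `β(u_i, u_i) ≠ 0`. -/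
def IsProdOfReflections (β : Matrix ι ι k) (g : orthGroup β) (us : List (ι → k)) : Prop :=
  (∀ u ∈ us, bil β u u ≠ 0) ∧ toMat g = (us.map (refl β)).prod

/-- The group of square classes `k^× / k^{×2}`. -/
abbrev SqClass (k : Type*) [Field k] : Type _ := kˣ ⧸ Subgroup.square kˣ

/-- The class of `a` in `k^× / k^{×2}`. -/
def sqClass (a : kˣ) : SqClass k := QuotientGroup.mk a

open Classical in
/-- The spinor norm: the class of `∏ ½ β(u_i, u_i)` in `k^× / k^{×2}`,
where `g = ρ_{u₁} ⋯ ρ_{u_m}` is written as a product of reflections. (One such expression is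
chosen; the value `1` is used if there were none.) -/
def spinorNorm (β : Matrix ι ι k) (g : orthGroup β) : SqClass k :=
  if h : ∃ a : kˣ, ∃ us : List (ι → k), IsProdOfReflections β g us ∧
      (a : k) = (us.map fun u => bil β u u / 2).prod
  then sqClass h.choose else 1

/-- `Ops R C g h`: the matrix `h` is obtained from `g` by finitely many row operations
`g ↦ x g` with `x ∈ R` and column operations `g ↦ g x` with `x ∈ C`, in any order. -/
def Ops (R C : Set (Matrix ι ι k)) : Matrix ι ι k → Matrix ι ι k → Prop :=
  Relation.ReflTransGen fun g h => (∃ x ∈ R, h = x * g) ∨ (∃ x ∈ C, h = g * x)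

end General

/-! ### Elementary matrices

The rows and columns are indexed by `ι`; the map `p` gives the indices `1, …, l`, the map `n` the
indices `-1, …, -l`, and `z` (in odd dimension) is the index `0`. -/

section Elementary

variable {ι : Type*} [Fintype ι] [DecidableEq ι] {l : ℕ}

/-- `x_{i,j}(t) = I + t (e_{i,j} - e_{-j,-i})` for `i ≠ j`. -/
def E1 (k : Type*) [Field k] (p n : Fin l → ι) : Set (Matrix ι ι k) :=
  {x | ∃ (i j : Fin l) (t : k), i ≠ j ∧
    x = 1 + t • (single (p i) (p j) 1 - single (n j) (n i) 1)}

/-- `x_{i,-j}(t) = I + t (e_{i,-j} - e_{j,-i})` for `i < j`. -/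
def E2 (k : Type*) [Field k] (p n : Fin l → ι) : Set (Matrix ι ι k) :=
  {x | ∃ (i j : Fin l) (t : k), i < j ∧
    x = 1 + t • (single (p i) (n j) 1 - single (p j) (n i) 1)}

/-- `x_{-i,j}(t) = I + t (e_{-i,j} - e_{-j,i})` for `i < j`. -/
def E3 (k : Type*) [Field k] (p n : Fin l → ι) : Set (Matrix ι ι k) :=
  {x | ∃ (i j : Fin l) (t : k), i < j ∧
    x = 1 + t • (single (n i) (p j) 1 - single (n j) (p i) 1)}

/-- `x_{i,0}(t) = I + t (2 e_{i,0} - e_{0,-i}) - t² e_{i,-i}` and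
`x_{0,i}(t) = I + t (-2 e_{-i,0} + e_{0,i}) - t² e_{-i,i}`. -/
def E4 (k : Type*) [Field k] (z : ι) (p n : Fin l → ι) : Set (Matrix ι ι k) :=
  {x | ∃ (i : Fin l) (t : k),
    x = 1 + t • ((2 : k) • single (p i) z 1 - single z (n i) 1) - t ^ 2 • single (p i) (n i) 1 ∨
    x = 1 + t • (-((2 : k) • single (n i) z 1) + single z (p i) 1) - t ^ 2 • single (n i) (p i) 1}

/-- `I - e_{i,i} - e_{-i,-i} - e_{i,-i} - e_{-i,i}`. -/
def wMat (k : Type*) [Field k] (p n : Fin l → ι) (i : Fin l) : Matrix ι ι k :=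
  1 - single (p i) (p i) 1 - single (n i) (n i) 1 - single (p i) (n i) 1 - single (n i) (p i) 1

/-- The singleton of `w_l`, the above matrix for `i = l` (indices in `Fin l` start at `0`). -/
def Ew (k : Type*) [Field k] (p n : Fin l → ι) : Set (Matrix ι ι k) :=
  {x | ∃ i : Fin l, (i : ℕ) + 1 = l ∧ x = wMat k p n i}

/-- The block `A` of `g`: rows and columns `1, …, l`. -/
def blockA {k : Type*} (p : Fin l → ι) (g : Matrix ι ι k) : Matrix (Fin l) (Fin l) k :=
  g.submatrix p p

/-- The block `C` of `g`: rows `-1, …, -l` and columns `1, …, l`. -/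
def blockC {k : Type*} (p n : Fin l → ι) (g : Matrix ι ι k) : Matrix (Fin l) (Fin l) k :=
  g.submatrix n p

end Elementary

section Shapes

variable {k : Type*} [Field k]

/-- The `l × l` matrix `diag(1, …, 1, c)`. -/
def diagLam (l : ℕ) (c : k) : Matrix (Fin l) (Fin l) k :=
  diagonal fun i => if (i : ℕ) + 1 = l then c else 1

/-- The `l × l` matrix `diag(1, …, 1, 0, …, 0)` with `m` ones. -/
def diagRank (k : Type*) [Field k] (l m : ℕ) : Matrix (Fin l) (Fin l) k :=
  diagonal fun i => if (i : ℕ) < m then 1 else 0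

end Shapes

/-! ### Even dimension `2l`: indices `1, …, l, -1, …, -l` -/

section Even

variable {l : ℕ} {k : Type*} [Field k]

abbrev EvenIdx (l : ℕ) : Type := Fin l ⊕ Fin l

/-- The split form in dimension `2l`. -/
def evenForm (l : ℕ) (k : Type*) [Field k] : Matrix (EvenIdx l) (EvenIdx l) k :=
  fromBlocks 0 1 1 0

def ep : Fin l → EvenIdx l := Sum.inl
def en : Fin l → EvenIdx l := Sum.inr

/-- All elementary matrices in dimension `2l`. -/
def EvenElem (l : ℕ) (k : Type*) [Field k] : Set (Matrix (EvenIdx l) (EvenIdx l) k) :=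
  E1 k ep en ∪ E2 k ep en ∪ E3 k ep en ∪ Ew k ep en

/-- The product of the interchanges `w_{i,-i}` of `i` and `-i` for `m < i ≤ l`. -/
def evenSwap (k : Type*) [Field k] (l m : ℕ) : Matrix (EvenIdx l) (EvenIdx l) k :=
  (((List.finRange l).filter fun i : Fin l => m ≤ (i : ℕ)).map (wMat k ep en)).prod

/-- `diag(1, …, 1, λ, 1, …, 1, λ⁻¹)`. -/
def evenDiag (l : ℕ) (lam : kˣ) : Matrix (EvenIdx l) (EvenIdx l) k :=
  fromBlocks (diagLam l (lam : k)) 0 0 (diagLam l ((lam⁻¹ : kˣ) : k))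

/-- Step 1: by ER1 and EC1 the block `A` is brought to the form `diag(1, …, 1, λ)`, `λ ≠ 0`,
or `diag(1, …, 1, 0, …, 0)`. -/
def EvenStep1 (g g₁ : Matrix (EvenIdx l) (EvenIdx l) k) : Prop :=
  Ops (E1 k ep en) (E1 k ep en) g g₁ ∧
    ((∃ lam : kˣ, blockA ep g₁ = diagLam l (lam : k)) ∨
      ∃ m < l, blockA ep g₁ = diagRank k l m)

/-- Step 2: if `A` is `diag(1, …, 1, λ)`, then `C` is made zero by ER3. If `A` has `m < l` ones and
zeros otherwise, then the upper left `m × m` block of `C` is made zero by ER3, the rows `i` and `-i`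
are interchanged for `i > m`, and `A` is made diagonal again by ER1 and EC1. -/
def EvenStep2 (g₁ g₂ : Matrix (EvenIdx l) (EvenIdx l) k) : Prop :=
  (((∃ lam : kˣ, blockA ep g₁ = diagLam l (lam : k)) ∧ Ops (E3 k ep en) ∅ g₁ g₂) ∨
    (∃ m < l, blockA ep g₁ = diagRank k l m ∧
      ∃ h, Ops (E3 k ep en) ∅ g₁ h ∧
        (∀ i j : Fin l, (i : ℕ) < m → (j : ℕ) < m → blockC ep en h i j = 0) ∧
        Ops (E1 k ep en) (E1 k ep en) (evenSwap k l m * h) g₂)) ∧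
  ∃ (lam : kˣ) (B : Matrix (Fin l) (Fin l) k),
    g₂ = fromBlocks (diagLam l (lam : k)) B 0 (diagLam l ((lam⁻¹ : kˣ) : k))

/-- Step 3: the block `B` is made zero by ER2, leaving `diag(1, …, 1, λ, 1, …, 1, λ⁻¹)`. -/
def EvenStep3 (g₂ : Matrix (EvenIdx l) (EvenIdx l) k) (lam : kˣ) : Prop :=
  Ops (E2 k ep en) ∅ g₂ (evenDiag l lam)

/-- A run of the elimination algorithm on `g` ends in `diag(1, …, 1, λ, 1, …, 1, λ⁻¹)`. -/
def EvenOutputs (g : Matrix (EvenIdx l) (EvenIdx l) k) (lam : kˣ) : Prop :=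
  ∃ g₁ g₂, EvenStep1 g g₁ ∧ EvenStep2 g₁ g₂ ∧ EvenStep3 g₂ lam

/-- Some sequence of elementary row and column operations, in whatever order, turns `g` into
`diag(1, …, 1, λ, 1, …, 1, λ⁻¹)`. -/
def EvenReduces (g : Matrix (EvenIdx l) (EvenIdx l) k) (lam : kˣ) : Prop :=
  Ops (EvenElem l k) (EvenElem l k) g (evenDiag l lam)

end Even

/-! ### Odd dimension `2l + 1`: indices `0, 1, …, l, -1, …, -l` -/

section Odd

variable {l : ℕ} {k : Type*} [Field k]

abbrev OddIdx (l : ℕ) : Type := Unit ⊕ (Fin l ⊕ Fin l)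

/-- The split form in dimension `2l + 1`. -/
def oddForm (l : ℕ) (k : Type*) [Field k] : Matrix (OddIdx l) (OddIdx l) k :=
  fromBlocks (diagonal fun _ => 2) 0 0 (fromBlocks 0 1 1 0)

def oz : OddIdx l := Sum.inl ()
def op : Fin l → OddIdx l := fun i => Sum.inr (Sum.inl i)
def on : Fin l → OddIdx l := fun i => Sum.inr (Sum.inr i)

/-- All elementary matrices in dimension `2l + 1`. -/
def OddElem (l : ℕ) (k : Type*) [Field k] : Set (Matrix (OddIdx l) (OddIdx l) k) :=
  E1 k op on ∪ E2 k op on ∪ E3 k op on ∪ E4 k oz op on ∪ Ew k op on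

/-- The product of the interchanges `w_{i,-i} = I - 2 e_{0,0} - e_{i,-i} - e_{-i,i} - e_{i,i} -
e_{-i,-i}` for `m < i ≤ l`. -/
def oddSwap (k : Type*) [Field k] (l m : ℕ) : Matrix (OddIdx l) (OddIdx l) k :=
  (((List.finRange l).filter fun i : Fin l => m ≤ (i : ℕ)).map
    fun i => wMat k op on i - (2 : k) • single oz oz 1).prod

/-- The block matrix with rows `(α, 0, 0)`, `(0, A, B)`, `(0, 0, D)`. -/
def oddBlock (a : k) (A B D : Matrix (Fin l) (Fin l) k) : Matrix (OddIdx l) (OddIdx l) k :=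
  fromBlocks (diagonal fun _ => a) 0 0 (fromBlocks A B 0 D)

/-- `diag(α, 1, …, 1, λ, 1, …, 1, λ⁻¹)`. -/
def oddDiag (l : ℕ) (a : k) (lam : kˣ) : Matrix (OddIdx l) (OddIdx l) k :=
  oddBlock a (diagLam l (lam : k)) 0 (diagLam l ((lam⁻¹ : kˣ) : k))

/-- Step 1: by ER1 and EC1 the block `A` is brought to the form `diag(1, …, 1, λ)`, `λ ≠ 0`,
or `diag(1, …, 1, 0, …, 0)`. -/
def OddStep1 (g g₁ : Matrix (OddIdx l) (OddIdx l) k) : Prop :=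
  Ops (E1 k op on) (E1 k op on) g g₁ ∧
    ((∃ lam : kˣ, blockA op g₁ = diagLam l (lam : k)) ∨
      ∃ m < l, blockA op g₁ = diagRank k l m)

/-- The first `m` entries of the row `X` (row `0`, columns `1, …, l`) and of the column `E`
(rows `1, …, l`, column `0`) vanish. -/
def XEZero (m : ℕ) (g : Matrix (OddIdx l) (OddIdx l) k) : Prop :=
  ∀ i : Fin l, (i : ℕ) < m → g oz (op i) = 0 ∧ g (op i) oz = 0

/-- The form of the matrix in the first case after Step 2: `A = diag(1, …, 1, λ)`, `X = 0 = E`. -/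
def OddFull (g : Matrix (OddIdx l) (OddIdx l) k) : Prop :=
  (∃ lam : kˣ, blockA op g = diagLam l (lam : k)) ∧ XEZero l g

/-- The form of the matrix in the second case after Step 2: `A = diag(1, …, 1, 0, …, 0)` with
`m < l` ones, and the first `m` entries of `X` and `E` vanish. -/
def OddPartial (m : ℕ) (g : Matrix (OddIdx l) (OddIdx l) k) : Prop :=
  m < l ∧ blockA op g = diagRank k l m ∧ XEZero m g

/-- Step 2: `X` and `E` are cleared as far as `A` allows, by ER4, ER4a, EC4, EC4a. -/
def OddStep2 (g₁ g₂ : Matrix (OddIdx l) (OddIdx l) k) : Prop :=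
  Ops (E4 k oz op on) (E4 k oz op on) g₁ g₂ ∧ (OddFull g₂ ∨ ∃ m, OddPartial m g₂)

/-- Step 3: by ER3, `C` is made zero in the first case, and its upper left `m × m` block is made
zero in the second case. -/
def OddStep3 (g₂ g₃ : Matrix (OddIdx l) (OddIdx l) k) : Prop :=
  Ops (E3 k op on) ∅ g₂ g₃ ∧
    ((OddFull g₃ ∧ blockC op on g₃ = 0) ∨
      ∃ m, OddPartial m g₃ ∧
        ∀ i j : Fin l, (i : ℕ) < m → (j : ℕ) < m → blockC op on g₃ i j = 0)

/-- Step 4: nothing is done in the first case. In the second case `i` and `-i` are interchanged for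
`i > m`, then `A` is made diagonal by ER1 and EC1, and then `X` and `E` are cleared by ER4, ER4a,
EC4, EC4a. -/
def OddStep4 (g₃ g₄ : Matrix (OddIdx l) (OddIdx l) k) : Prop :=
  ((OddFull g₃ ∧ g₄ = g₃) ∨
    (∃ m, OddPartial m g₃ ∧ ∃ h, Ops (E1 k op on) (E1 k op on) (oddSwap k l m * g₃) h ∧
      Ops (E4 k oz op on) (E4 k oz op on) h g₄)) ∧
  ∃ (a : k) (lam : kˣ) (B : Matrix (Fin l) (Fin l) k),
    g₄ = oddBlock a (diagLam l (lam : k)) B (diagLam l ((lam⁻¹ : kˣ) : k))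

/-- Step 5: the block `B` is made zero by ER2, leaving `diag(α, 1, …, 1, λ, 1, …, 1, λ⁻¹)`. -/
def OddStep5 (g₄ : Matrix (OddIdx l) (OddIdx l) k) (lam : kˣ) : Prop :=
  ∃ a : k, Ops (E2 k op on) ∅ g₄ (oddDiag l a lam)

/-- A run of the elimination algorithm on `g` ends in some `diag(α, 1, …, 1, λ, 1, …, 1, λ⁻¹)`. -/
def OddOutputs (g : Matrix (OddIdx l) (OddIdx l) k) (lam : kˣ) : Prop :=
  ∃ g₁ g₂ g₃ g₄, OddStep1 g g₁ ∧ OddStep2 g₁ g₂ ∧ OddStep3 g₂ g₃ ∧ OddStep4 g₃ g₄ ∧ OddStep5 g₄ lam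

/-- Some sequence of elementary row and column operations, in whatever order, turns `g` into
`diag(α, 1, …, 1, λ, 1, …, 1, λ⁻¹)` for some `α`. -/
def OddReduces (g : Matrix (OddIdx l) (OddIdx l) k) (lam : kˣ) : Prop :=
  ∃ a : k, Ops (OddElem l k) (OddElem l k) g (oddDiag l a lam)

end Odd

end

end SplitOrth

/-!
By Cartan and Dieudonné, every isometry is a product of reflections. If `ρ_{u₁} ⋯ ρ_{uₘ} = 1`, then
the product of the `uᵢ` in the Clifford algebra of `½ β(u, u)` commutes with all vectors up to the
sign `(-1)ᵐ`, so it is annihilated by all contractions and hence is a scalar `a`; comparing it with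
its reverse gives `∏ ½ β(uᵢ, uᵢ) = a²`. Thus `Θ` is a well defined homomorphism.

An elementary matrix of one of the types 1 to 4 is the exponential `exp (tN)` of a nilpotent matrix,
so it is the square of `exp (tN/2)` and lies in the kernel of `Θ`. The interchanges lie there too,
as products of reflections in vectors `u` with `½ β(u, u) = 1`. So `Θ(g)` is the spinor norm of the
final diagonal matrix, which is the class of `λ`.

For the commutator subgroup, let `e`, `f` span a hyperbolic plane. Every reflection is conjugate to
some `ρ_{e + a f}`, whose class in the abelianization depends on `a` only modulo squares, and
`a ↦ [ρ_{e + f} ρ_{e + a f}]` is a homomorphism. So the class of an element of determinant `1` is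
determined by its spinor norm.

The algorithm does not get stuck because the isometry relations `ᵗg β g = β` force `ᵗA C` to be
skew symmetric up to the contribution of `X`, and force `A` to be invertible once `C` vanishes.
-/

namespace SplitOrth

noncomputable section

/-! ### Elements of a Clifford algebra annihilated by all contractions -/

section Clifford

open CliffordAlgebra

variable {R M : Type*} [CommRing R] [AddCommGroup M] [Module R M] {Q : QuadraticForm R M}

theorem contractLeft_eq_zero_of_mem_adjoin {d : Module.Dual R M} {S : Set M}
    (hd : ∀ m ∈ S, d m = 0) {x : CliffordAlgebra Q} (hx : x ∈ Algebra.adjoin R (ι Q '' S)) :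
    contractLeft d x = 0 := by
  suffices h : ∀ y, contractLeft d (x * y) = involute x * contractLeft d y by simpa using h 1
  induction hx using Algebra.adjoin_induction with
  | mem x hx =>
    obtain ⟨m, hm, rfl⟩ := hx
    simp [contractLeft_ι_mul, hd m hm]
  | algebraMap r => simp [contractLeft_algebraMap_mul]
  | add x x' _ _ hx hx' => simp [add_mul, hx, hx']
  | mul x x' _ _ hx hx' => simp [mul_assoc, hx, hx']

theorem involute_mem_adjoin {S : Set M} {x : CliffordAlgebra Q}
    (hx : x ∈ Algebra.adjoin R (ι Q '' S)) : involute x ∈ Algebra.adjoin R (ι Q '' S) := by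
  induction hx using Algebra.adjoin_induction with
  | mem x hx =>
    obtain ⟨m, hm, rfl⟩ := hx
    rw [involute_ι]
    exact neg_mem (Algebra.subset_adjoin ⟨m, hm, rfl⟩)
  | algebraMap r => simp
  | add x x' _ _ hx hx' => rw [map_add]; exact add_mem hx hx'
  | mul x x' _ _ hx hx' => rw [map_mul]; exact mul_mem hx hx'

theorem mul_ι_of_mem_adjoin {S : Set M} {w : M} (hw : ∀ m ∈ S, QuadraticMap.polar Q m w = 0)
    {x : CliffordAlgebra Q} (hx : x ∈ Algebra.adjoin R (ι Q '' S)) :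
    x * ι Q w = ι Q w * involute x := by
  induction hx using Algebra.adjoin_induction with
  | mem x hx =>
    obtain ⟨m, hm, rfl⟩ := hx
    rw [ι_mul_ι_comm, hw m hm, involute_ι]
    simp
  | algebraMap r => simp [Algebra.commutes]
  | add x x' _ _ hx hx' => simp [add_mul, mul_add, hx, hx']
  | mul x x' _ _ hx hx' => rw [mul_assoc, hx', ← mul_assoc, hx, map_mul, mul_assoc]

theorem exists_eq_add_ι_mul_of_mem_adjoin_insert {S : Set M} {w : M}
    (hw : ∀ m ∈ S, QuadraticMap.polar Q m w = 0)
    {x : CliffordAlgebra Q} (hx : x ∈ Algebra.adjoin R (ι Q '' insert w S)) :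
    ∃ b ∈ Algebra.adjoin R (ι Q '' S), ∃ c ∈ Algebra.adjoin R (ι Q '' S), x = b + ι Q w * c := by
  induction hx using Algebra.adjoin_induction with
  | mem x hx =>
    obtain ⟨m, rfl | hm, rfl⟩ := hx
    · exact ⟨0, zero_mem _, 1, one_mem _, by simp⟩
    · exact ⟨_, Algebra.subset_adjoin ⟨m, hm, rfl⟩, 0, zero_mem _, by simp⟩
  | algebraMap r => exact ⟨_, Subalgebra.algebraMap_mem _ r, 0, zero_mem _, by simp⟩
  | add x x' _ _ hx hx' =>
    obtain ⟨b, hb, c, hc, rfl⟩ := hx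
    obtain ⟨b', hb', c', hc', rfl⟩ := hx'
    exact ⟨_, add_mem hb hb', _, add_mem hc hc', by rw [mul_add]; abel⟩
  | mul x x' _ _ hx hx' =>
    obtain ⟨b, hb, c, hc, rfl⟩ := hx
    obtain ⟨b', hb', c', hc', rfl⟩ := hx'
    refine ⟨b * b' + algebraMap R _ (Q w) * (involute c * c'),
      add_mem (mul_mem hb hb') (mul_mem (Subalgebra.algebraMap_mem _ _)
        (mul_mem (involute_mem_adjoin hc) hc')),
      involute b * c' + c * b',
      add_mem (mul_mem (involute_mem_adjoin hb) hc') (mul_mem hc hb'), ?_⟩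
    have hbw : b * (ι Q w * c') = ι Q w * (involute b * c') := by
      rw [← mul_assoc, mul_ι_of_mem_adjoin hw hb, mul_assoc]
    have hwcw : ι Q w * c * (ι Q w * c') = algebraMap R _ (Q w) * (involute c * c') := by
      rw [mul_assoc, ← mul_assoc c, mul_ι_of_mem_adjoin hw hc, mul_assoc (ι Q w), ← mul_assoc,
        ι_sq_scalar]
    rw [add_mul, mul_add, mul_add, hbw, hwcw, mul_add, mul_assoc (ι Q w)]
    abel

theorem mem_adjoin_of_contractLeft_eq_zero {S : Set M} {w : M} {d : Module.Dual R M}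
    (hw : ∀ m ∈ S, QuadraticMap.polar Q m w = 0) (hd : ∀ m ∈ S, d m = 0) (hdw : d w = 1)
    {x : CliffordAlgebra Q} (hx : x ∈ Algebra.adjoin R (ι Q '' insert w S))
    (hdx : contractLeft d x = 0) : x ∈ Algebra.adjoin R (ι Q '' S) := by
  obtain ⟨b, hb, c, hc, rfl⟩ := exists_eq_add_ι_mul_of_mem_adjoin_insert hw hx
  have hc0 : c = 0 := by
    simpa [contractLeft_ι_mul, contractLeft_eq_zero_of_mem_adjoin hd hb,
      contractLeft_eq_zero_of_mem_adjoin hd hc, hdw] using hdx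
  simpa [hc0] using hb

theorem adjoin_ι_image_eq_top {S : Set M} (hS : Submodule.span R S = ⊤) :
    Algebra.adjoin R (ι Q '' S) = ⊤ := by
  rw [← Algebra.adjoin_span, ← Submodule.map_span, hS, Submodule.map_top, LinearMap.coe_range,
    adjoin_range_ι]

theorem mem_range_algebraMap_of_contractLeft_eq_zero {κ : Type*} [Finite κ]
    (v : Module.Basis κ R M) (hv : Pairwise fun i j => QuadraticMap.polar Q (v i) (v j) = 0)
    {x : CliffordAlgebra Q} (hx : ∀ d : Module.Dual R M, contractLeft d x = 0) :
    x ∈ (algebraMap R (CliffordAlgebra Q)).range := by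
  suffices h : ∀ s : Set κ, s.Finite → x ∈ Algebra.adjoin R (ι Q '' (v '' sᶜ)) by
    simpa [Algebra.mem_bot] using h Set.univ Set.finite_univ
  intro s hs
  induction s, hs using Set.Finite.induction_on with
  | empty =>
    rw [Set.compl_empty, Set.image_univ, adjoin_ι_image_eq_top v.span_eq]
    exact Algebra.mem_top
  | @insert i s hi _ ih =>
    have hne : ∀ j ∈ (insert i s)ᶜ, j ≠ i := by
      rintro j hj rfl
      exact hj (Set.mem_insert j s)
    have hcompl : sᶜ = insert i (insert i s)ᶜ := by
      ext j
      by_cases hj : j = i <;> simp_all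
    rw [hcompl, Set.image_insert_eq] at ih
    refine mem_adjoin_of_contractLeft_eq_zero (d := v.coord i) ?_ ?_ (by simp) ih (hx _)
    · rintro _ ⟨j, hj, rfl⟩
      exact hv (hne j hj)
    · rintro _ ⟨j, hj, rfl⟩
      simp [hne j hj]

theorem contractLeft_polarBilin_prod_ι (x : M) (us : List M) :
    contractLeft (QuadraticMap.polarBilin Q x) (us.map (ι Q)).prod =
      ι Q x * (us.map (ι Q)).prod - involute (us.map (ι Q)).prod * ι Q x := by
  induction us with
  | nil => simp
  | cons u us ih =>
    rw [List.map_cons, List.prod_cons, contractLeft_ι_mul, ih, map_mul, involute_ι,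
      QuadraticMap.polarBilin_apply_apply, Algebra.smul_def, ← ι_mul_ι_add_swap]
    noncomm_ring

theorem reverse_prod_ι_mul_prod_ι (us : List M) :
    reverse (us.map (ι Q)).prod * (us.map (ι Q)).prod = algebraMap R _ (us.map Q).prod := by
  induction us with
  | nil => simp
  | cons u us ih =>
    rw [List.map_cons, List.prod_cons, reverse.map_mul, reverse_ι, mul_assoc,
      ← mul_assoc (ι Q u), ι_sq_scalar, Algebra.left_comm, ih, List.map_cons, List.prod_cons,
      map_mul]

end Clifford

/-! ### Reflections -/

section Reflections

section

variable {ι k : Type*} [Fintype ι] [Field k] {β : Matrix ι ι k}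

theorem bil_comm (hβ : β.IsSymm) (u v : ι → k) : bil β u v = bil β v u := by
  rw [bil, bil, dotProduct_mulVec, ← mulVec_transpose, hβ, dotProduct_comm]

theorem bil_add_left (u u' v : ι → k) : bil β (u + u') v = bil β u v + bil β u' v :=
  add_dotProduct u u' _

theorem bil_add_right (u v v' : ι → k) : bil β u (v + v') = bil β u v + bil β u v' := by
  rw [bil, mulVec_add, dotProduct_add, bil, bil]

theorem bil_sub_left (u u' v : ι → k) : bil β (u - u') v = bil β u v - bil β u' v :=
  sub_dotProduct u u' _

theorem bil_sub_right (u v v' : ι → k) : bil β u (v - v') = bil β u v - bil β u v' := by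
  rw [bil, mulVec_sub, dotProduct_sub, bil, bil]

theorem bil_smul_left (c : k) (u v : ι → k) : bil β (c • u) v = c * bil β u v :=
  smul_dotProduct c u _

theorem bil_smul_right (c : k) (u v : ι → k) : bil β u (c • v) = c * bil β u v := by
  rw [bil, mulVec_smul, dotProduct_smul, smul_eq_mul, bil]

theorem bil_neg_left (u v : ι → k) : bil β (-u) v = -bil β u v :=
  neg_dotProduct u _

theorem bil_neg_right (u v : ι → k) : bil β u (-v) = -bil β u v := by
  rw [bil, mulVec_neg, dotProduct_neg, bil]

/-- `g` preserves the form with matrix `β`; for nonsingular `β` these are the matrices of the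
elements of `orthGroup β`. -/
def Preserves (β g : Matrix ι ι k) : Prop := gᵀ * β * g = β

theorem preserves_iff_bil {g : Matrix ι ι k} :
    Preserves β g ↔ ∀ u v, bil β (g *ᵥ u) (g *ᵥ v) = bil β u v := by
  classical
  have h : ∀ u v, bil β (g *ᵥ u) (g *ᵥ v) = bil (gᵀ * β * g) u v := fun u v => by
    rw [bil, bil, ← mulVec_mulVec, ← mulVec_mulVec, dotProduct_mulVec u, vecMul_transpose]
  simp only [h]
  refine ⟨fun hg u v => by rw [show gᵀ * β * g = β from hg], fun hg => Matrix.ext fun i j => ?_⟩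
  simpa [bil] using hg (Pi.single i 1) (Pi.single j 1)

theorem Preserves.mul {g h : Matrix ι ι k} (hg : Preserves β g) (hh : Preserves β h) :
    Preserves β (g * h) := by
  rw [preserves_iff_bil] at *
  intro u v
  rw [← mulVec_mulVec, ← mulVec_mulVec, hg, hh]

end

variable {ι k : Type*} [Fintype ι] [DecidableEq ι] [Field k] {β : Matrix ι ι k}

theorem Preserves.exists_toMat_eq (hdet : IsUnit β.det) {g : Matrix ι ι k} (hg : Preserves β g) :
    ∃ h : orthGroup β, toMat h = g := by
  have hu : IsUnit g.det := by
    rw [← show gᵀ * β * g = β from hg, det_mul] at hdet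
    exact isUnit_of_mul_isUnit_right hdet
  exact ⟨⟨((isUnit_iff_isUnit_det g).mpr hu).unit, hg⟩, rfl⟩

theorem preserves_toMat (g : orthGroup β) : Preserves β (toMat g) := g.2

theorem toMat_mul (g h : orthGroup β) : toMat (g * h) = toMat g * toMat h := rfl

theorem toMat_injective : Function.Injective (toMat : orthGroup β → Matrix ι ι k) :=
  fun _ _ h => Subtype.ext (Units.ext h)

theorem orthGroup_ext {g h : orthGroup β} (hgh : ∀ x, toMat g *ᵥ x = toMat h *ᵥ x) : g = h :=
  toMat_injective (Matrix.ext_of_mulVec_single fun _ => hgh _)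

theorem bil_toMat_mulVec (g : orthGroup β) (u v : ι → k) :
    bil β (toMat g *ᵥ u) (toMat g *ᵥ v) = bil β u v :=
  preserves_iff_bil.mp (preserves_toMat g) u v

theorem refl_mulVec (u v : ι → k) :
    refl β u *ᵥ v = v - (2 * bil β u v / bil β u u) • u := by
  rw [refl, sub_mulVec, one_mulVec, smul_mulVec, vecMulVec_mulVec, ← dotProduct_mulVec, ← bil]
  ext i
  simp only [op_smul_eq_smul, Pi.sub_apply, Pi.smul_apply, smul_eq_mul]
  ring

theorem refl_mul_refl {u : ι → k} (hu : bil β u u ≠ 0) : refl β u * refl β u = 1 := by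
  refine Matrix.ext_of_mulVec_single fun i => ?_
  rw [← mulVec_mulVec, one_mulVec]
  simp only [refl_mulVec, bil_sub_right, bil_smul_right]
  ext j
  simp only [Pi.sub_apply, Pi.smul_apply, smul_eq_mul]
  field_simp
  ring

theorem refl_mulVec_self {u : ι → k} (hu : bil β u u ≠ 0) : refl β u *ᵥ u = -u := by
  rw [refl_mulVec, mul_div_cancel_right₀ _ hu, two_smul]
  abel

theorem refl_mulVec_of_orthogonal {u v : ι → k} (h : bil β u v = 0) : refl β u *ᵥ v = v := by
  simp [refl_mulVec, h]

theorem refl_smul {c : k} (hc : c ≠ 0) (u : ι → k) : refl β (c • u) = refl β u := by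
  refine Matrix.ext_of_mulVec_single fun i => ?_
  rw [refl_mulVec, refl_mulVec, bil_smul_left, bil_smul_left, bil_smul_right, smul_smul]
  congr 2
  by_cases hu : bil β u u = 0
  · simp [hu]
  · field_simp

theorem refl_sub_mulVec (hβ : β.IsSymm) {x y : ι → k} (hxy : bil β x x = bil β y y)
    (h : bil β (x - y) (x - y) ≠ 0) : refl β (x - y) *ᵥ x = y := by
  have hx : 2 * bil β (x - y) x = bil β (x - y) (x - y) := by
    simp only [bil_sub_left, bil_sub_right, bil_comm hβ y x, hxy]
    ring
  rw [refl_mulVec, hx, div_self h, one_smul, sub_sub_cancel]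

theorem preserves_refl (hβ : β.IsSymm) {u : ι → k} (hu : bil β u u ≠ 0) :
    Preserves β (refl β u) := by
  rw [preserves_iff_bil]
  intro x y
  simp only [refl_mulVec, bil_sub_left, bil_sub_right, bil_smul_left, bil_smul_right,
    bil_comm hβ x u]
  field_simp
  ring

theorem det_refl {u : ι → k} (hu : bil β u u ≠ 0) : (refl β u).det = -1 := by
  have h : refl β u =
      1 + replicateCol Unit (-(2 / bil β u u) • u) * replicateRow Unit (u ᵥ* β) := by
    rw [refl, sub_eq_add_neg, ← vecMulVec_eq, smul_vecMulVec, neg_smul]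
  rw [h, det_one_add_replicateCol_mul_replicateRow, dotProduct_smul, ← dotProduct_mulVec, ← bil,
    smul_eq_mul, neg_mul, div_mul_cancel₀ _ hu]
  norm_num

/-- The reflection `ρ_u` as an element of the orthogonal group. -/
def reflection (hβ : β.IsSymm) (u : ι → k) (hu : bil β u u ≠ 0) : orthGroup β :=
  ⟨⟨refl β u, refl β u, refl_mul_refl hu, refl_mul_refl hu⟩, preserves_refl hβ hu⟩

theorem toMat_reflection (hβ : β.IsSymm) {u : ι → k} (hu : bil β u u ≠ 0) :
    toMat (reflection hβ u hu) = refl β u := rfl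

theorem reflection_mul_self (hβ : β.IsSymm) {u : ι → k} (hu : bil β u u ≠ 0) :
    reflection hβ u hu * reflection hβ u hu = 1 :=
  toMat_injective (refl_mul_refl hu)

theorem mul_reflection (hβ : β.IsSymm) (g : orthGroup β) {u v : ι → k} (hu : bil β u u ≠ 0)
    (hv : bil β v v ≠ 0) (huv : toMat g *ᵥ u = v) :
    g * reflection hβ u hu = reflection hβ v hv * g := by
  subst huv
  refine orthGroup_ext fun x => ?_
  simp only [toMat_mul, toMat_reflection, ← mulVec_mulVec, refl_mulVec, bil_toMat_mulVec,
    mulVec_sub, mulVec_smul]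

namespace IsProdOfReflections

theorem one : IsProdOfReflections β 1 [] := ⟨by simp, rfl⟩

theorem mul {g h : orthGroup β} {us vs : List (ι → k)} (hg : IsProdOfReflections β g us)
    (hh : IsProdOfReflections β h vs) : IsProdOfReflections β (g * h) (us ++ vs) :=
  ⟨List.forall_mem_append.mpr ⟨hg.1, hh.1⟩,
    by rw [toMat_mul, hg.2, hh.2, List.map_append, List.prod_append]⟩

theorem of_reflection (hβ : β.IsSymm) {u : ι → k} (hu : bil β u u ≠ 0) :
    IsProdOfReflections β (reflection hβ u hu) [u] :=
  ⟨by simpa using hu, by simp [toMat_reflection]⟩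

theorem exists_eq_mul (hβ : β.IsSymm) {g : orthGroup β} {u : ι → k} {us : List (ι → k)}
    (hg : IsProdOfReflections β g (u :: us)) :
    ∃ (hu : bil β u u ≠ 0) (h : orthGroup β),
      IsProdOfReflections β h us ∧ g = reflection hβ u hu * h := by
  obtain ⟨hu, hus⟩ := List.forall_mem_cons.mp hg.1
  refine ⟨hu, reflection hβ u hu * g, ⟨hus, ?_⟩, ?_⟩
  · rw [toMat_mul, toMat_reflection, hg.2, List.map_cons, List.prod_cons, ← mul_assoc,
      refl_mul_refl hu, one_mul]
  · rw [← mul_assoc, reflection_mul_self, one_mul]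

theorem inv (hβ : β.IsSymm) {g : orthGroup β} {us : List (ι → k)}
    (hg : IsProdOfReflections β g us) : IsProdOfReflections β g⁻¹ us.reverse := by
  induction us generalizing g with
  | nil => rwa [show g = 1 from toMat_injective hg.2, inv_one] at *
  | cons u us ih =>
    obtain ⟨hu, h, hh, rfl⟩ := hg.exists_eq_mul hβ
    rw [_root_.mul_inv_rev, inv_eq_of_mul_eq_one_left (reflection_mul_self hβ hu),
      List.reverse_cons]
    exact (ih hh).mul (of_reflection hβ hu)

theorem det {g : orthGroup β} {us : List (ι → k)} (hg : IsProdOfReflections β g us) :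
    (toMat g).det = (-1) ^ us.length := by
  have hdet : us.map (detMonoidHom ∘ refl β) = us.map fun _ => -1 :=
    List.map_congr_left fun u hu => det_refl (hg.1 u hu)
  rw [hg.2, ← coe_detMonoidHom, map_list_prod, List.map_map, hdet, List.map_const',
    List.prod_replicate]

end IsProdOfReflections

variable [NeZero (2 : k)]

theorem exists_orthogonal_basis (hβ : β.IsSymm) (hdet : IsUnit β.det) :
    ∃ (m : ℕ) (v : Module.Basis (Fin m) k (ι → k)),
      (Pairwise fun i j => bil β (v i) (v j) = 0) ∧ ∀ i, bil β (v i) (v i) ≠ 0 := by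
  have : Invertible (2 : k) := invertibleOfNonzero two_ne_zero
  have hbil : ∀ u v, Matrix.toBilin' β u v = bil β u v := Matrix.toBilin'_apply' β
  have hsymm : LinearMap.IsSymm (Matrix.toBilin' β) :=
    ⟨fun u v => by simp only [RingHom.id_apply, hbil, bil_comm hβ u]⟩
  obtain ⟨v, hv⟩ := LinearMap.BilinForm.exists_orthogonal_basis hsymm
  have hnd : (Matrix.toBilin' β).Nondegenerate :=
    Matrix.Nondegenerate.toBilin' (Matrix.nondegenerate_of_det_ne_zero hdet.ne_zero)
  refine ⟨_, v, fun i j hij => ?_, fun i => ?_⟩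
  · exact (hbil _ _).symm.trans (hv hij)
  · rw [← hbil]
    exact hv.not_isOrtho_basis_self_of_separatingLeft hnd.1 i

theorem exists_isProdOfReflections_mulVec_eq (hβ : β.IsSymm) {x y : ι → k}
    (hxy : bil β x x = bil β y y) (hy : bil β y y ≠ 0) :
    ∃ (g : orthGroup β) (us : List (ι → k)), IsProdOfReflections β g us ∧ toMat g *ᵥ x = y ∧
      ∀ z, bil β x z = 0 → bil β y z = 0 → toMat g *ᵥ z = z := by
  by_cases h : bil β (x - y) (x - y) = 0
  · -- By the parallelogram law `x + y` is then anisotropic, and `ρ_y ρ_{x + y}` maps `x` to `y`.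
    have hsum : bil β (x - -y) (x - -y) ≠ 0 := by
      have : bil β (x + y) (x + y) = 2 * 2 * bil β y y := by
        simp only [bil_sub_left, bil_sub_right, bil_add_left, bil_add_right, bil_comm hβ y x,
          hxy] at h ⊢
        linear_combination -h
      rw [sub_neg_eq_add, this]
      exact mul_ne_zero (mul_ne_zero two_ne_zero two_ne_zero) hy
    have hxy' : bil β x x = bil β (-y) (-y) := by
      rw [hxy, bil_neg_left, bil_neg_right, neg_neg]
    refine ⟨_, _, (IsProdOfReflections.of_reflection hβ hy).mul (.of_reflection hβ hsum), ?_,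
      fun z hz hz' => ?_⟩
    · rw [toMat_mul, ← mulVec_mulVec, toMat_reflection, toMat_reflection,
        refl_sub_mulVec hβ hxy' hsum, mulVec_neg, refl_mulVec_self hy, neg_neg]
    · rw [toMat_mul, ← mulVec_mulVec, toMat_reflection, toMat_reflection,
        refl_mulVec_of_orthogonal (u := x - -y)
          (by rw [bil_sub_left, bil_neg_left, hz, hz', neg_zero, sub_zero]),
        refl_mulVec_of_orthogonal hz']
  · exact ⟨_, _, .of_reflection hβ h, refl_sub_mulVec hβ hxy h, fun z hz hz' =>
      refl_mulVec_of_orthogonal (by rw [bil_sub_left, hz, hz', sub_zero])⟩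

theorem exists_isProdOfReflections (hβ : β.IsSymm) (hdet : IsUnit β.det) (g : orthGroup β) :
    ∃ us, IsProdOfReflections β g us := by
  obtain ⟨m, v, hv, hv'⟩ := exists_orthogonal_basis hβ hdet
  obtain ⟨h, us, hus, hfix⟩ : ∃ (h : orthGroup β) (us : List (ι → k)),
      IsProdOfReflections β h us ∧ ∀ i ∈ Finset.univ, toMat (h * g) *ᵥ v i = v i := by
    induction (Finset.univ : Finset (Fin m)) using Finset.induction_on with
    | empty => exact ⟨1, [], .one, by simp⟩
    | insert i s hi ih =>
      obtain ⟨h, us, hus, hfix⟩ := ih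
      obtain ⟨r, ws, hws, hri, hr⟩ := exists_isProdOfReflections_mulVec_eq hβ
        (bil_toMat_mulVec (h * g) (v i) (v i)) (hv' i)
      refine ⟨r * h, ws ++ us, hws.mul hus, Finset.forall_mem_insert _ _ _ |>.mpr ⟨?_, ?_⟩⟩
      · rw [mul_assoc, toMat_mul, ← mulVec_mulVec, hri]
      · intro j hj
        have hij : i ≠ j := ne_of_mem_of_not_mem hj hi |>.symm
        rw [mul_assoc, toMat_mul, ← mulVec_mulVec, hfix j hj]
        refine hr _ ?_ (hv hij)
        rw [← hv hij, ← bil_toMat_mulVec (h * g) (v i), hfix j hj]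
  have hhg : h * g = 1 := toMat_injective <| (Matrix.toLin' (R := k)).injective <|
    v.ext fun i => by simpa [toMat] using hfix i (Finset.mem_univ i)
  exact ⟨us.reverse, eq_inv_of_mul_eq_one_right hhg ▸ hus.inv hβ⟩

end Reflections

/-! ### The spinor norm -/

section SpinorNorm

variable {ι k : Type*} [Fintype ι] [DecidableEq ι] [Field k] [NeZero (2 : k)] {β : Matrix ι ι k}

/-- The quadratic form `½ β(u, u)`, whose Clifford algebra contains the relation `ι u ² = ½ β(u, u)`
matching the normalization of the spinor norm. -/
def quadForm (β : Matrix ι ι k) : QuadraticForm k (ι → k) :=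
  LinearMap.BilinMap.toQuadraticMap ((2⁻¹ : k) • Matrix.toBilin' β)

omit [NeZero (2 : k)] in
theorem quadForm_apply (u : ι → k) : quadForm β u = bil β u u / 2 := by
  simp [quadForm, bil, Matrix.toBilin'_apply', div_eq_inv_mul]

theorem polar_quadForm (hβ : β.IsSymm) (u v : ι → k) :
    QuadraticMap.polar (quadForm β) u v = bil β u v := by
  simp only [QuadraticMap.polar, quadForm_apply, bil_add_left, bil_add_right, bil_comm hβ v u]
  field_simp
  ring

theorem exists_polarBilin_quadForm_eq (hβ : β.IsSymm) (hdet : IsUnit β.det)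
    (d : Module.Dual k (ι → k)) : ∃ x, QuadraticMap.polarBilin (quadForm β) x = d := by
  refine ⟨(fun i => d (Pi.single i 1)) ᵥ* β⁻¹, LinearMap.pi_ext' fun i => LinearMap.ext_ring ?_⟩
  simp [-mulVec_single, polar_quadForm hβ, bil, dotProduct_mulVec,
    vecMul_vecMul, nonsing_inv_mul β hdet]

open CliffordAlgebra in
theorem IsProdOfReflections.involute_prod_ι_mul_ι (hβ : β.IsSymm) {g : orthGroup β}
    {us : List (ι → k)} (hg : IsProdOfReflections β g us) (x : ι → k) :
    involute (us.map (CliffordAlgebra.ι (quadForm β))).prod * CliffordAlgebra.ι (quadForm β) x =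
      CliffordAlgebra.ι (quadForm β) (toMat g *ᵥ x) *
        (us.map (CliffordAlgebra.ι (quadForm β))).prod := by
  induction us generalizing g with
  | nil => simp [hg.2]
  | cons u us ih =>
    obtain ⟨hu, h, hh, rfl⟩ := hg.exists_eq_mul hβ
    rw [List.map_cons, List.prod_cons, map_mul, involute_ι, mul_assoc, ih hh, toMat_mul,
      toMat_reflection, ← mulVec_mulVec, ← mul_assoc, ← mul_assoc]
    generalize toMat h *ᵥ x = y
    have hc : 2 * bil β u y / bil β u u * (bil β u u / 2) = bil β u y := by field_simp
    rw [refl_mulVec, map_sub, map_smul, sub_mul, smul_mul_assoc, ι_sq_scalar, quadForm_apply,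
      neg_mul, ι_mul_ι_comm, polar_quadForm hβ, Algebra.smul_def, ← map_mul (algebraMap k _), hc,
      neg_sub]

theorem IsProdOfReflections.isSquare_prod (hβ : β.IsSymm) (hdet : IsUnit β.det)
    {us : List (ι → k)} (hus : IsProdOfReflections β 1 us) :
    IsSquare (us.map fun u => bil β u u / 2).prod := by
  have : Invertible (2 : k) := invertibleOfNonzero two_ne_zero
  obtain ⟨m, v, hv, -⟩ := exists_orthogonal_basis hβ hdet
  obtain ⟨c, hc⟩ := mem_range_algebraMap_of_contractLeft_eq_zero v
    (fun i j hij => (polar_quadForm hβ _ _).trans (hv hij))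
    (x := (us.map (CliffordAlgebra.ι (quadForm β))).prod) fun d => by
      obtain ⟨x, rfl⟩ := exists_polarBilin_quadForm_eq hβ hdet d
      rw [contractLeft_polarBilin_prod_ι, hus.involute_prod_ι_mul_ι hβ,
        show toMat (1 : orthGroup β) = 1 from rfl, one_mulVec, sub_self]
  have hnorm := reverse_prod_ι_mul_prod_ι (Q := quadForm β) us
  rw [← hc, CliffordAlgebra.reverse.commutes, ← map_mul] at hnorm
  simp only [← quadForm_apply]
  exact ⟨c, ((algebraMap k (CliffordAlgebra (quadForm β))).injective hnorm).symm⟩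

section SqClass

omit [NeZero (2 : k)]

theorem sqClass_mul (a b : kˣ) : sqClass (a * b) = sqClass a * sqClass b := rfl

theorem sqClass_one : sqClass (1 : kˣ) = 1 := rfl

theorem sqClass_eq_one {a : kˣ} : sqClass a = 1 ↔ IsSquare a :=
  (QuotientGroup.eq_one_iff a).trans Subgroup.mem_square

theorem isSquare_coe_units {a : kˣ} : IsSquare (a : k) ↔ IsSquare a := by
  refine ⟨fun ⟨r, hr⟩ => ?_, fun h => h.map (Units.coeHom k)⟩
  have hr' : r ≠ 0 := by
    rintro rfl
    exact a.ne_zero (by rw [hr, zero_mul])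
  exact ⟨Units.mk0 r hr', Units.ext hr⟩

theorem SqClass.mul_self (x : SqClass k) : x * x = 1 := by
  induction x using QuotientGroup.induction_on with
  | H a => exact sqClass_eq_one.mpr ⟨a, rfl⟩

theorem SqClass.mul_eq_one_iff {x y : SqClass k} : x * y = 1 ↔ x = y := by
  rw [← x.mul_self, mul_right_inj, eq_comm]

end SqClass

theorem IsProdOfReflections.exists_units_eq_prod {g : orthGroup β} {us : List (ι → k)}
    (hg : IsProdOfReflections β g us) :
    ∃ a : kˣ, (a : k) = (us.map fun u => bil β u u / 2).prod := by
  refine ⟨Units.mk0 _ (List.prod_ne_zero ?_), rfl⟩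
  rw [List.mem_map]
  rintro ⟨u, hu, h⟩
  exact div_ne_zero (hg.1 u hu) two_ne_zero h

theorem spinorNorm_eq (hβ : β.IsSymm) (hdet : IsUnit β.det) {g : orthGroup β}
    {us : List (ι → k)} (hus : IsProdOfReflections β g us) {a : kˣ}
    (ha : (a : k) = (us.map fun u => bil β u u / 2).prod) : spinorNorm β g = sqClass a := by
  have h : ∃ a : kˣ, ∃ us : List (ι → k), IsProdOfReflections β g us ∧
      (a : k) = (us.map fun u => bil β u u / 2).prod := ⟨a, us, hus, ha⟩
  rw [spinorNorm, dif_pos h]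
  obtain ⟨vs, hvs, hb⟩ := h.choose_spec
  have hone := hvs.mul (hus.inv hβ)
  rw [mul_inv_cancel] at hone
  have hsq := hone.isSquare_prod hβ hdet
  rw [List.map_append, List.prod_append, List.map_reverse, List.prod_reverse, ← ha, ← hb,
    ← Units.val_mul, isSquare_coe_units, ← sqClass_eq_one, sqClass_mul] at hsq
  exact SqClass.mul_eq_one_iff.mp hsq

theorem spinorNorm_mul (hβ : β.IsSymm) (hdet : IsUnit β.det) (g h : orthGroup β) :
    spinorNorm β (g * h) = spinorNorm β g * spinorNorm β h := by
  obtain ⟨us, hus⟩ := exists_isProdOfReflections hβ hdet g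
  obtain ⟨vs, hvs⟩ := exists_isProdOfReflections hβ hdet h
  obtain ⟨a, ha⟩ := hus.exists_units_eq_prod
  obtain ⟨b, hb⟩ := hvs.exists_units_eq_prod
  rw [spinorNorm_eq hβ hdet hus ha, spinorNorm_eq hβ hdet hvs hb, ← sqClass_mul]
  exact spinorNorm_eq hβ hdet (hus.mul hvs) (by simp [ha, hb])

/-- The spinor norm as a group homomorphism. -/
def spinorHom (hβ : β.IsSymm) (hdet : IsUnit β.det) : orthGroup β →* SqClass k :=
  MonoidHom.mk' (spinorNorm β) (spinorNorm_mul hβ hdet)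

end SpinorNorm

/-! ### The kernel of the spinor norm -/

section Commutator

variable {ι k : Type*} [Fintype ι] [DecidableEq ι] [Field k] [NeZero (2 : k)] {β : Matrix ι ι k}

theorem abelianization_reflection_eq (hβ : β.IsSymm) {u v : ι → k} (hu : bil β u u ≠ 0)
    (hv : bil β v v ≠ 0) (huv : bil β u u = bil β v v) :
    Abelianization.of (reflection hβ u hu) = Abelianization.of (reflection hβ v hv) := by
  obtain ⟨g, -, -, hg, -⟩ := exists_isProdOfReflections_mulVec_eq hβ huv hv
  have hconj := congrArg Abelianization.of (mul_reflection hβ g hu hv hg)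
  rw [map_mul, map_mul, mul_comm] at hconj
  exact mul_right_cancel hconj

/-- `(e, f)` spans a hyperbolic plane: `e` and `f` are isotropic and `β(e, f) = 1`. -/
structure IsHyperbolicPair (β : Matrix ι ι k) (e f : ι → k) : Prop where
  left : bil β e e = 0
  right : bil β f f = 0
  bil_eq_one : bil β e f = 1

namespace IsHyperbolicPair

variable {e f : ι → k}

omit [DecidableEq ι] [NeZero (2 : k)] in
theorem bil_add_smul_self (hef : IsHyperbolicPair β e f) (hβ : β.IsSymm) (a : k) :
    bil β (e + a • f) (e + a • f) = 2 * a := by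
  simp only [bil_add_left, bil_add_right, bil_smul_left, bil_smul_right, hef.left, hef.right,
    bil_comm hβ f e, hef.bil_eq_one]
  ring

omit [DecidableEq ι] in
theorem bil_add_smul_self_ne_zero (hef : IsHyperbolicPair β e f) (hβ : β.IsSymm) (a : kˣ) :
    bil β (e + (a : k) • f) (e + (a : k) • f) ≠ 0 := by
  rw [hef.bil_add_smul_self hβ]
  exact mul_ne_zero two_ne_zero a.ne_zero

theorem refl_mulVec_refl_mulVec (hef : IsHyperbolicPair β e f) (hβ : β.IsSymm) (a b : kˣ)
    (x : ι → k) :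
    refl β (e + (a : k) • f) *ᵥ (refl β (e + (b : k) • f) *ᵥ x) =
      x + ((b / a - 1) * bil β f x) • e + ((a / b - 1) * bil β e x) • f := by
  simp only [refl_mulVec, hef.bil_add_smul_self hβ, bil_sub_right, bil_add_left, bil_add_right,
    bil_smul_left, bil_smul_right, hef.left, hef.right, bil_comm hβ f e, hef.bil_eq_one]
  ext i
  have ha := a.ne_zero
  have hb := b.ne_zero
  simp only [Pi.sub_apply, Pi.add_apply, Pi.smul_apply, smul_eq_mul]
  field_simp
  ring

/-- The class of the reflection `ρ_{e + a f}` in the abelianization, where `½ β(u, u) = a` for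
`u = e + a f`. -/
def reflectionClass (hef : IsHyperbolicPair β e f) (hβ : β.IsSymm) (a : kˣ) :
    Abelianization (orthGroup β) :=
  Abelianization.of (reflection hβ (e + (a : k) • f) (hef.bil_add_smul_self_ne_zero hβ a))

theorem of_reflection (hef : IsHyperbolicPair β e f) (hβ : β.IsSymm) {u : ι → k}
    (hu : bil β u u ≠ 0) {a : kˣ} (ha : bil β u u = 2 * a) :
    Abelianization.of (reflection hβ u hu) = hef.reflectionClass hβ a :=
  abelianization_reflection_eq hβ hu _ (ha.trans (hef.bil_add_smul_self hβ a).symm)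

theorem reflectionClass_mul_self (hef : IsHyperbolicPair β e f) (hβ : β.IsSymm) (a : kˣ) :
    hef.reflectionClass hβ a * hef.reflectionClass hβ a = 1 := by
  rw [reflectionClass, ← map_mul, reflection_mul_self, map_one]

theorem reflectionClass_mul_sq (hef : IsHyperbolicPair β e f) (hβ : β.IsSymm) (a c : kˣ) :
    hef.reflectionClass hβ (a * (c * c)) = hef.reflectionClass hβ a := by
  have hc : bil β ((c : k) • (e + (a : k) • f)) ((c : k) • (e + (a : k) • f)) =
      2 * (a * (c * c) : kˣ) := by
    rw [bil_smul_left, bil_smul_right, hef.bil_add_smul_self hβ]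
    push_cast
    ring
  rw [← hef.of_reflection hβ (hc ▸ mul_ne_zero two_ne_zero (Units.ne_zero _)) hc]
  exact congrArg _ (toMat_injective (refl_smul c.ne_zero _))

theorem reflectionClass_mul (hef : IsHyperbolicPair β e f) (hβ : β.IsSymm) (a b : kˣ) :
    hef.reflectionClass hβ a * hef.reflectionClass hβ b =
      hef.reflectionClass hβ 1 * hef.reflectionClass hβ (a * b) := by
  -- `ρ_{e + a f} ρ_{e + b f}` only depends on `b / a`, which agrees with `a * b` up to a square.
  have hab : hef.reflectionClass hβ a * hef.reflectionClass hβ b =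
      hef.reflectionClass hβ 1 * hef.reflectionClass hβ (b / a) := by
    simp only [reflectionClass, ← map_mul]
    refine congrArg _ (orthGroup_ext fun x => ?_)
    simp only [toMat_mul, toMat_reflection, ← mulVec_mulVec, hef.refl_mulVec_refl_mulVec hβ]
    simp
  rw [hab, ← hef.reflectionClass_mul_sq hβ (b / a) a, ← mul_assoc (b / a), div_mul_cancel,
    mul_comm b]

/-- The homomorphism `a ↦ [ρ_{e + f} ρ_{e + a f}]` to the abelianization. Since it factors through
the square classes, it is a partial inverse of the spinor norm. -/
def reflectionHom (hef : IsHyperbolicPair β e f) (hβ : β.IsSymm) :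
    kˣ →* Abelianization (orthGroup β) where
  toFun a := hef.reflectionClass hβ 1 * hef.reflectionClass hβ a
  map_one' := hef.reflectionClass_mul_self hβ 1
  map_mul' a b := by
    rw [mul_mul_mul_comm, hef.reflectionClass_mul_self hβ 1, one_mul,
      hef.reflectionClass_mul hβ a b]

theorem reflectionHom_eq_one_of_isSquare (hef : IsHyperbolicPair β e f) (hβ : β.IsSymm) {a : kˣ}
    (ha : IsSquare a) : hef.reflectionHom hβ a = 1 := by
  obtain ⟨c, rfl⟩ := ha
  change _ * hef.reflectionClass hβ (c * c) = 1
  rw [← one_mul (c * c), reflectionClass_mul_sq, reflectionClass_mul_self]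

theorem of_eq_of_isProdOfReflections (hef : IsHyperbolicPair β e f) (hβ : β.IsSymm)
    {g : orthGroup β} {us : List (ι → k)} (hus : IsProdOfReflections β g us) {a : kˣ}
    (ha : (a : k) = (us.map fun u => bil β u u / 2).prod) :
    Abelianization.of g = hef.reflectionClass hβ 1 ^ us.length * hef.reflectionHom hβ a := by
  induction us generalizing g a with
  | nil =>
    obtain rfl : a = 1 := Units.ext ha
    rw [show g = 1 from toMat_injective hus.2, map_one, map_one, List.length_nil, pow_zero,
      one_mul]
  | cons u us ih =>
    obtain ⟨hu, h, hh, rfl⟩ := hus.exists_eq_mul hβ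
    obtain ⟨b, hb⟩ := hh.exists_units_eq_prod
    set c : kˣ := Units.mk0 (bil β u u / 2) (div_ne_zero hu two_ne_zero) with hc
    obtain rfl : a = c * b := Units.ext (by simp [ha, hb, hc])
    have hcu : Abelianization.of (reflection hβ u hu) =
        hef.reflectionClass hβ 1 * hef.reflectionHom hβ c := by
      change _ = _ * (_ * hef.reflectionClass hβ c)
      rw [← mul_assoc, reflectionClass_mul_self, one_mul,
        hef.of_reflection hβ hu (a := c) (mul_div_cancel₀ _ two_ne_zero).symm]
    rw [map_mul, hcu, ih hh hb, map_mul, List.length_cons, pow_succ', mul_mul_mul_comm]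

/-- A nonsingular form that contains a hyperbolic plane has no other invariants than determinant
and spinor norm on the abelianized orthogonal group. -/
theorem mem_commutator_iff (hef : IsHyperbolicPair β e f) (hβ : β.IsSymm) (hdet : IsUnit β.det)
    {g : orthGroup β} (hg : (toMat g).det = 1) :
    g ∈ commutator (orthGroup β) ↔ spinorNorm β g = 1 := by
  refine ⟨fun h => Abelianization.commutator_subset_ker (spinorHom hβ hdet) h, fun h => ?_⟩
  obtain ⟨us, hus⟩ := exists_isProdOfReflections hβ hdet g
  obtain ⟨a, ha⟩ := hus.exists_units_eq_prod
  rw [spinorNorm_eq hβ hdet hus ha, sqClass_eq_one] at h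
  have hlen : Even us.length := by
    have hneg : (-1 : k) ≠ 1 := fun h => two_ne_zero (α := k) (by linear_combination -h)
    by_contra hodd
    rw [hus.det, (Nat.not_even_iff_odd.mp hodd).neg_one_pow] at hg
    exact hneg hg
  obtain ⟨j, hj⟩ := hlen
  rw [← Abelianization.ker_of, MonoidHom.mem_ker, hef.of_eq_of_isProdOfReflections hβ hus ha,
    hef.reflectionHom_eq_one_of_isSquare hβ h, mul_one, hj, pow_add, ← mul_pow,
    reflectionClass_mul_self, one_pow]

end IsHyperbolicPair

end Commutator

/-! ### Matrices with a given spinor norm -/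

section HasSpinorNorm

variable {ι k : Type*} [Fintype ι] [DecidableEq ι] [Field k] {β : Matrix ι ι k}

/-- `x` is the matrix of an orthogonal transformation of spinor norm `c`. -/
def HasSpinorNorm (β x : Matrix ι ι k) (c : SqClass k) : Prop :=
  ∃ y : orthGroup β, toMat y = x ∧ spinorNorm β y = c

theorem HasSpinorNorm.preserves {x : Matrix ι ι k} {c : SqClass k} (h : HasSpinorNorm β x c) :
    Preserves β x := by
  obtain ⟨y, rfl, -⟩ := h
  exact preserves_toMat y

theorem HasSpinorNorm.unique {x : Matrix ι ι k} {c d : SqClass k} (h : HasSpinorNorm β x c)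
    (h' : HasSpinorNorm β x d) : c = d := by
  obtain ⟨y, rfl, rfl⟩ := h
  obtain ⟨y', hy, rfl⟩ := h'
  rw [toMat_injective hy]

variable [NeZero (2 : k)]

theorem HasSpinorNorm.mul (hβ : β.IsSymm) (hdet : IsUnit β.det) {x x' : Matrix ι ι k}
    {c c' : SqClass k} (h : HasSpinorNorm β x c) (h' : HasSpinorNorm β x' c') :
    HasSpinorNorm β (x * x') (c * c') := by
  obtain ⟨y, rfl, rfl⟩ := h
  obtain ⟨y', rfl, rfl⟩ := h'
  exact ⟨y * y', rfl, spinorNorm_mul hβ hdet _ _⟩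

theorem hasSpinorNorm_one (hβ : β.IsSymm) (hdet : IsUnit β.det) : HasSpinorNorm β 1 1 :=
  ⟨1, rfl, map_one (spinorHom hβ hdet)⟩

theorem HasSpinorNorm.list_prod (hβ : β.IsSymm) (hdet : IsUnit β.det) {L : List (Matrix ι ι k)}
    (hL : ∀ x ∈ L, HasSpinorNorm β x 1) : HasSpinorNorm β L.prod 1 := by
  induction L with
  | nil => exact hasSpinorNorm_one hβ hdet
  | cons x L ih =>
    obtain ⟨hx, hL⟩ := List.forall_mem_cons.mp hL
    simpa using hx.mul hβ hdet (ih hL)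

theorem hasSpinorNorm_refl (hβ : β.IsSymm) (hdet : IsUnit β.det) {u : ι → k} {c : kˣ}
    (hu : bil β u u = 2 * c) : HasSpinorNorm β (refl β u) (sqClass c) := by
  have hu' : bil β u u ≠ 0 := hu ▸ mul_ne_zero two_ne_zero c.ne_zero
  exact ⟨reflection hβ u hu', rfl, spinorNorm_eq hβ hdet (.of_reflection hβ hu')
    (by simp [hu, mul_div_cancel_left₀ (c : k) two_ne_zero])⟩

/-- The matrices of the isometries of `β` whose spinor norm is trivial. -/
def spinorKernel (β : Matrix ι ι k) : Set (Matrix ι ι k) := {x | HasSpinorNorm β x 1}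

theorem HasSpinorNorm.of_ops (hβ : β.IsSymm) (hdet : IsUnit β.det) {g h : Matrix ι ι k}
    (hops : Ops (spinorKernel β) (spinorKernel β) g h) {c : SqClass k} (hg : HasSpinorNorm β g c) :
    HasSpinorNorm β h c := by
  induction hops with
  | refl => exact hg
  | tail _ hstep ih =>
    rcases hstep with ⟨x, hx, rfl⟩ | ⟨x, hx, rfl⟩
    · simpa using HasSpinorNorm.mul hβ hdet hx ih
    · simpa using ih.mul hβ hdet hx

/-- The exponential of `t N` when `N ^ 3 = 0`. -/
def expCubeZero (N : Matrix ι ι k) (t : k) : Matrix ι ι k := 1 + t • N + (t ^ 2 / 2) • (N * N)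

theorem expCubeZero_mul_expCubeZero {N : Matrix ι ι k} (hN3 : N * N * N = 0) (s t : k) :
    expCubeZero N s * expCubeZero N t = expCubeZero N (s + t) := by
  have hN3' : N * (N * N) = 0 := by rw [← mul_assoc, hN3]
  have hN4 : N * N * (N * N) = 0 := by rw [← mul_assoc, hN3, zero_mul]
  have hst : (s + t) ^ 2 / 2 = t ^ 2 / 2 + s * t + s ^ 2 / 2 := by field_simp; ring
  simp only [expCubeZero, add_mul, mul_add, one_mul, mul_one, smul_mul_assoc, mul_smul_comm, hN4,
    hN3', hN3, smul_zero, add_zero, hst, add_smul, smul_add, smul_smul, mul_comm t s]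
  abel

theorem preserves_expCubeZero {N : Matrix ι ι k} (hN : β * N = -(Nᵀ * β)) (hN3 : N * N * N = 0)
    (t : k) : Preserves β (expCubeZero N t) := by
  have hNN : (N * N)ᵀ * β = β * (N * N) := by
    rw [transpose_mul, ← mul_assoc, hN, neg_mul, mul_assoc Nᵀ β N, hN, mul_neg, neg_neg, mul_assoc]
  have hadjoint : (expCubeZero N t)ᵀ * β = β * expCubeZero N (-t) := by
    simp only [expCubeZero, transpose_add, transpose_smul, transpose_one, add_mul, mul_add,
      one_mul, mul_one, smul_mul_assoc, mul_smul_comm, hNN, neg_sq, neg_smul, mul_neg, hN,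
      smul_neg, neg_neg]
  rw [Preserves, hadjoint, mul_assoc, expCubeZero_mul_expCubeZero hN3, neg_add_cancel]
  simp [expCubeZero]

theorem hasSpinorNorm_expCubeZero (hβ : β.IsSymm) (hdet : IsUnit β.det) {N : Matrix ι ι k}
    (hN : β * N = -(Nᵀ * β)) (hN3 : N * N * N = 0) (t : k) :
    HasSpinorNorm β (expCubeZero N t) 1 := by
  obtain ⟨y, hy⟩ := (preserves_expCubeZero hN hN3 (t / 2)).exists_toMat_eq hdet
  have hhalf : HasSpinorNorm β (expCubeZero N (t / 2)) (spinorNorm β y) := ⟨y, hy, rfl⟩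
  simpa only [SqClass.mul_self, expCubeZero_mul_expCubeZero hN3, add_halves]
    using hhalf.mul hβ hdet hhalf

end HasSpinorNorm

/-! ### The spinor norms of the elementary matrices -/

section ElementaryMatrices

section

variable {ι k : Type*} [Fintype ι] [DecidableEq ι] [Field k] {β : Matrix ι ι k}

theorem mul_single_of_col_eq {a b : ι} {w : k} (h : β.col a = Pi.single b w) (d : ι) (x : k) :
    β * single a d x = single b d (w * x) := by
  ext i j
  have hi : β i a = (Pi.single b w : ι → k) i := congrFun h i
  rcases eq_or_ne d j with rfl | hd
  · rw [mul_single_apply_same, hi, Pi.single_apply, single_apply, ite_mul, zero_mul]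
    simp only [eq_comm, and_true]
  · rw [mul_single_apply_of_ne _ _ _ _ _ hd.symm, single_apply_of_col_ne _ _ hd]

theorem single_mul_of_col_eq (hβ : β.IsSymm) {a b : ι} {w : k} (h : β.col a = Pi.single b w)
    (d : ι) (x : k) : single d a x * β = single d b (w * x) := by
  rw [← transpose_inj, transpose_mul, hβ, transpose_single, mul_single_of_col_eq h,
    transpose_single]

theorem bil_single_of_col_eq (hβ : β.IsSymm) {a b : ι} {w : k} (h : β.col a = Pi.single b w)
    (x : ι → k) : bil β (Pi.single a 1) x = w * x b := by
  rw [bil_comm hβ, bil, mulVec_single_one, h, dotProduct_single, mul_comm]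

end

variable {ι k : Type*} [Fintype ι] [DecidableEq ι] [Field k] {l : ℕ}

/-- The indices `p i` and `n i`, playing the roles of `1, …, l` and `-1, …, -l`, are all
distinct. -/
structure IsSignedIndexing {ι : Type*} (p n : Fin l → ι) : Prop where
  injective_pos : Function.Injective p
  injective_neg : Function.Injective n
  pos_ne_neg : ∀ i j, p i ≠ n j

theorem IsSignedIndexing.swap {ι : Type*} {p n : Fin l → ι} (hs : IsSignedIndexing p n) :
    IsSignedIndexing n p where
  injective_pos := hs.injective_neg
  injective_neg := hs.injective_pos
  pos_ne_neg i j := (hs.pos_ne_neg j i).symm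

/-- `β` is a nonsingular symmetric form in which the basis vectors with the indices `p i` and `n i`
span mutually orthogonal hyperbolic planes, orthogonal to all other basis vectors. -/
structure IsSplit (β : Matrix ι ι k) (p n : Fin l → ι) : Prop extends IsSignedIndexing p n where
  isSymm : β.IsSymm
  isUnit_det : IsUnit β.det
  col_pos : ∀ i, β.col (p i) = Pi.single (n i) 1
  col_neg : ∀ i, β.col (n i) = Pi.single (p i) 1

/-- The basis vector with index `z` has length `2` and is orthogonal to all others; `z` plays the
role of the index `0` in odd dimension. -/
structure IsMiddle (β : Matrix ι ι k) (z : ι) (p n : Fin l → ι) : Prop where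
  ne_pos : ∀ i, z ≠ p i
  ne_neg : ∀ i, z ≠ n i
  col_self : β.col z = Pi.single z 2

namespace IsSplit

variable {β : Matrix ι ι k} {p n : Fin l → ι} {z : ι}

theorem swap (hs : IsSplit β p n) : IsSplit β n p where
  toIsSignedIndexing := hs.toIsSignedIndexing.swap
  isSymm := hs.isSymm
  isUnit_det := hs.isUnit_det
  col_pos := hs.col_neg
  col_neg := hs.col_pos

theorem mul_single_pos (hs : IsSplit β p n) (i : Fin l) (d : ι) (x : k) :
    β * single (p i) d x = single (n i) d x := by
  rw [mul_single_of_col_eq (hs.col_pos i), one_mul]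

theorem single_pos_mul (hs : IsSplit β p n) (i : Fin l) (d : ι) (x : k) :
    single d (p i) x * β = single d (n i) x := by
  rw [single_mul_of_col_eq hs.isSymm (hs.col_pos i), one_mul]

theorem bil_pos (hs : IsSplit β p n) (i : Fin l) (x : ι → k) :
    bil β (Pi.single (p i) 1) x = x (n i) := by
  rw [bil_single_of_col_eq hs.isSymm (hs.col_pos i), one_mul]

theorem isHyperbolicPair (hs : IsSplit β p n) (i : Fin l) :
    IsHyperbolicPair β (Pi.single (p i) 1) (Pi.single (n i) 1) where
  left := by rw [hs.bil_pos, Pi.single_eq_of_ne (hs.pos_ne_neg i i).symm]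
  right := by rw [hs.swap.bil_pos, Pi.single_eq_of_ne (hs.pos_ne_neg i i)]
  bil_eq_one := by rw [hs.bil_pos, Pi.single_eq_same]

variable [NeZero (2 : k)]

theorem hasSpinorNorm_of_sq_eq_zero (hs : IsSplit β p n) {N : Matrix ι ι k}
    (hN : β * N = -(Nᵀ * β)) (hN2 : N * N = 0) (t : k) : HasSpinorNorm β (1 + t • N) 1 := by
  simpa [expCubeZero, hN2] using
    hasSpinorNorm_expCubeZero hs.isSymm hs.isUnit_det hN (by rw [hN2, zero_mul]) t

theorem E1_subset_spinorKernel (hs : IsSplit β p n) : E1 k p n ⊆ spinorKernel β := by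
  rintro _ ⟨i, j, t, hij, rfl⟩
  apply hs.hasSpinorNorm_of_sq_eq_zero
  · simp only [mul_sub, sub_mul, transpose_sub, transpose_single, hs.mul_single_pos,
      hs.swap.mul_single_pos, hs.single_pos_mul, hs.swap.single_pos_mul]
    abel
  · simp [mul_sub, sub_mul, hs.injective_pos.eq_iff, hs.injective_neg.eq_iff, hij, hij.symm,
      hs.pos_ne_neg, (hs.pos_ne_neg _ _).symm]

theorem E2_subset_spinorKernel (hs : IsSplit β p n) : E2 k p n ⊆ spinorKernel β := by
  rintro _ ⟨i, j, t, -, rfl⟩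
  apply hs.hasSpinorNorm_of_sq_eq_zero
  · simp only [mul_sub, sub_mul, transpose_sub, transpose_single, hs.mul_single_pos,
      hs.single_pos_mul]
    abel
  · simp [mul_sub, sub_mul, (hs.pos_ne_neg _ _).symm]

theorem E3_subset_spinorKernel (hs : IsSplit β p n) : E3 k p n ⊆ spinorKernel β :=
  hs.swap.E2_subset_spinorKernel

theorem hasSpinorNorm_shortRootElement (hs : IsSplit β p n) (hz : IsMiddle β z p n) (i : Fin l)
    (t : k) : HasSpinorNorm β (1 + t • ((2 : k) • single (p i) z 1 - single z (n i) 1) -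
      t ^ 2 • single (p i) (n i) 1) 1 := by
  set N : Matrix ι ι k := (2 : k) • single (p i) z 1 - single z (n i) 1 with hN
  have hNN : N * N = -((2 : k) • single (p i) (n i) 1) := by
    simp [hN, mul_sub, sub_mul, hz.ne_pos, (hz.ne_neg _).symm, (hs.pos_ne_neg _ _).symm]
  have hN3 : N * N * N = 0 := by
    rw [hNN]
    simp [hN, mul_sub, (hz.ne_neg _).symm, (hs.pos_ne_neg _ _).symm]
  have hNβ : β * N = -(Nᵀ * β) := by
    simp only [hN, mul_sub, sub_mul, transpose_sub, transpose_single, hs.mul_single_pos,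
      hs.single_pos_mul, mul_single_of_col_eq hz.col_self,
      single_mul_of_col_eq hs.isSymm hz.col_self, smul_single, smul_eq_mul]
    abel
  have hexp : 1 + t • N - t ^ 2 • single (p i) (n i) 1 = expCubeZero N t := by
    rw [expCubeZero, hNN, smul_neg, smul_smul, div_mul_cancel₀ _ two_ne_zero, sub_eq_add_neg]
  rw [hexp]
  exact hasSpinorNorm_expCubeZero hs.isSymm hs.isUnit_det hNβ hN3 t

theorem E4_subset_spinorKernel (hs : IsSplit β p n) (hz : IsMiddle β z p n) :
    E4 k z p n ⊆ spinorKernel β := by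
  rintro _ ⟨i, t, rfl | rfl⟩
  · exact hs.hasSpinorNorm_shortRootElement hz i t
  · have h := hs.swap.hasSpinorNorm_shortRootElement ⟨hz.ne_neg, hz.ne_pos, hz.col_self⟩ i (-t)
    rwa [neg_smul, ← smul_neg t, neg_sub, sub_eq_neg_add (single z (p i) 1), neg_sq] at h

theorem diagonal_eq_refl_mul_refl (hs : IsSplit β p n) (i : Fin l) (c : kˣ) :
    diagonal (fun a => if a = p i then (c : k) else if a = n i then (c : k)⁻¹ else 1) =
      refl β (Pi.single (p i) 1 + ((1 : kˣ) : k) • Pi.single (n i) 1) *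
      refl β (Pi.single (p i) 1 + (c : k) • Pi.single (n i) 1) := by
  refine Matrix.ext_of_mulVec_single fun j => ?_
  rw [← mulVec_mulVec, (hs.isHyperbolicPair i).refl_mulVec_refl_mulVec hs.isSymm, hs.bil_pos,
    hs.swap.bil_pos]
  generalize (Pi.single j 1 : ι → k) = x
  ext a
  simp only [mulVec_diagonal, Pi.add_apply, Pi.smul_apply, Pi.single_apply, smul_eq_mul]
  rcases eq_or_ne a (p i) with rfl | hp
  · simp only [↓reduceIte, Units.val_one, div_one, hs.pos_ne_neg]
    ring
  rcases eq_or_ne a (n i) with rfl | hn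
  · simp only [(hs.pos_ne_neg _ _).symm, ↓reduceIte, Units.val_one, div_one]
    ring
  · simp [hp, hn]

theorem hasSpinorNorm_diagonal (hs : IsSplit β p n) (i : Fin l) (c : kˣ) :
    HasSpinorNorm β
      (diagonal fun a => if a = p i then (c : k) else if a = n i then (c : k)⁻¹ else 1)
      (sqClass c) := by
  have hrefl : ∀ c : kˣ, HasSpinorNorm β (refl β (Pi.single (p i) 1 + (c : k) • Pi.single (n i) 1))
      (sqClass c) := fun c => hasSpinorNorm_refl hs.isSymm hs.isUnit_det
    ((hs.isHyperbolicPair i).bil_add_smul_self hs.isSymm _)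
  rw [hs.diagonal_eq_refl_mul_refl]
  simpa [sqClass_one] using (hrefl 1).mul hs.isSymm hs.isUnit_det (hrefl c)

theorem wMat_eq_refl (hs : IsSplit β p n) (i : Fin l) :
    wMat k p n i = refl β (Pi.single (p i) 1 + (1 : k) • Pi.single (n i) 1) := by
  refine Matrix.ext_of_mulVec_single fun j => ?_
  rw [refl_mulVec, (hs.isHyperbolicPair i).bil_add_smul_self hs.isSymm, bil_add_left,
    bil_smul_left, hs.bil_pos, hs.swap.bil_pos, mul_one, mul_div_cancel_left₀ _ two_ne_zero]
  generalize (Pi.single j 1 : ι → k) = x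
  ext a
  simp only [wMat, sub_mulVec, one_mulVec, single_mulVec, Pi.sub_apply, Function.update_apply,
    Pi.zero_apply, one_mul, Pi.smul_apply, Pi.add_apply, Pi.single_apply, smul_eq_mul]
  rcases eq_or_ne a (p i) with rfl | hp
  · simp [hs.pos_ne_neg]
  rcases eq_or_ne a (n i) with rfl | hn
  · simp [(hs.pos_ne_neg _ _).symm]
  · simp [hp, hn]

theorem hasSpinorNorm_wMat (hs : IsSplit β p n) (i : Fin l) :
    HasSpinorNorm β (wMat k p n i) 1 := by
  rw [hs.wMat_eq_refl, ← sqClass_one]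
  exact hasSpinorNorm_refl hs.isSymm hs.isUnit_det
    ((hs.isHyperbolicPair i).bil_add_smul_self hs.isSymm _)

theorem hasSpinorNorm_one_sub_two_smul_single (hs : IsSplit β p n) (hz : IsMiddle β z p n) :
    HasSpinorNorm β (1 - (2 : k) • single z z 1) 1 := by
  have hlen : bil β (Pi.single z 1) (Pi.single z 1) = 2 := by
    rw [bil_single_of_col_eq hs.isSymm hz.col_self, Pi.single_eq_same, mul_one]
  have hrefl : (1 - (2 : k) • single z z 1 : Matrix ι ι k) = refl β (Pi.single z 1) := by
    refine Matrix.ext_of_mulVec_single fun j => ?_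
    rw [refl_mulVec, hlen, bil_single_of_col_eq hs.isSymm hz.col_self,
      mul_div_cancel_left₀ _ two_ne_zero, sub_mulVec, one_mulVec, smul_mulVec, single_mulVec]
    generalize (Pi.single j 1 : ι → k) = x
    ext a
    simp [Function.update_apply, Pi.single_apply]
  rw [hrefl, ← sqClass_one]
  exact hasSpinorNorm_refl hs.isSymm hs.isUnit_det (by rw [hlen, Units.val_one, mul_one])

end IsSplit

end ElementaryMatrices

/-! ### The split forms -/

section SplitForms

variable {k : Type*} [Field k] {l : ℕ}

theorem isSplit_evenForm : IsSplit (evenForm l k) ep en where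
  isSymm := by simp [Matrix.IsSymm, evenForm, fromBlocks_transpose]
  isUnit_det := Matrix.isUnit_det_of_right_inverse (B := evenForm l k) (by
    simp [evenForm, fromBlocks_multiply])
  injective_pos := Sum.inl_injective
  injective_neg := Sum.inr_injective
  pos_ne_neg _ _ := Sum.inl_ne_inr
  col_pos i := by ext (a | a) <;> simp [evenForm, ep, en, one_apply, Pi.single_apply]
  col_neg i := by ext (a | a) <;> simp [evenForm, ep, en, one_apply, Pi.single_apply]

theorem isMiddle_oddForm : IsMiddle (oddForm l k) oz op on where
  ne_pos _ := Sum.inl_ne_inr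
  ne_neg _ := Sum.inl_ne_inr
  col_self := by ext (a | a | a) <;> simp [oddForm, oz]

theorem oddDiag_neg_one (c : kˣ) :
    oddDiag l (-1) c = (1 - (2 : k) • single oz oz 1) * oddDiag l 1 c := by
  have h : (1 - (2 : k) • single oz oz 1 : Matrix (OddIdx l) (OddIdx l) k) =
      fromBlocks (diagonal fun _ => -1) 0 0 1 := by
    ext (a | a) (b | b)
    · norm_num [oz, one_apply]
    all_goals simp [oz, one_apply]
  rw [h, oddDiag, oddDiag, oddBlock, oddBlock, fromBlocks_multiply]
  simp

variable [NeZero (2 : k)]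

theorem isSplit_oddForm : IsSplit (oddForm l k) op on where
  isSymm := by simp [Matrix.IsSymm, oddForm, fromBlocks_transpose]
  isUnit_det := Matrix.isUnit_det_of_right_inverse
    (B := fromBlocks (diagonal fun _ => 2⁻¹) 0 0 (fromBlocks 0 1 1 0)) (by
    simp [oddForm, fromBlocks_multiply, two_ne_zero])
  injective_pos := Sum.inr_injective.comp Sum.inl_injective
  injective_neg := Sum.inr_injective.comp Sum.inr_injective
  pos_ne_neg _ _ := by simp [op, on]
  col_pos i := by ext (a | a | a) <;> simp [oddForm, op, on, one_apply, Pi.single_apply]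
  col_neg i := by ext (a | a | a) <;> simp [oddForm, op, on, one_apply, Pi.single_apply]

theorem hasSpinorNorm_evenDiag (hl : 1 ≤ l) (c : kˣ) :
    HasSpinorNorm (evenForm l k) (evenDiag l c) (sqClass c) := by
  convert isSplit_evenForm.hasSpinorNorm_diagonal (⟨l - 1, by lia⟩ : Fin l) c using 1
  rw [evenDiag, diagLam, diagLam, fromBlocks_diagonal]
  congr 1
  have hi : ∀ a : Fin l, (a : ℕ) + 1 = l ↔ a = ⟨l - 1, by lia⟩ := by simp only [Fin.ext_iff]; lia
  ext (a | a) <;> simp [ep, en, hi]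

theorem hasSpinorNorm_oddDiag_one (hl : 1 ≤ l) (c : kˣ) :
    HasSpinorNorm (oddForm l k) (oddDiag l 1 c) (sqClass c) := by
  convert isSplit_oddForm.hasSpinorNorm_diagonal (⟨l - 1, by lia⟩ : Fin l) c using 1
  rw [oddDiag, oddBlock, diagLam, diagLam, fromBlocks_diagonal, fromBlocks_diagonal]
  congr 1
  have hi : ∀ a : Fin l, (a : ℕ) + 1 = l ↔ a = ⟨l - 1, by lia⟩ := by simp only [Fin.ext_iff]; lia
  ext (a | a | a) <;> simp [op, on, hi]

theorem eq_one_or_eq_neg_one_of_preserves_oddDiag {a : k} {c : kˣ}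
    (hp : Preserves (oddForm l k) (oddDiag l a c)) : a = 1 ∨ a = -1 := by
  have h : a * 2 * a = 2 := by
    simpa [oddDiag, oddBlock, oddForm, fromBlocks_transpose, fromBlocks_multiply, oz] using
      congrFun (congrFun hp oz) oz
  exact mul_self_eq_one_iff.mp (mul_left_cancel₀ two_ne_zero (by linear_combination h))

theorem hasSpinorNorm_oddDiag (hl : 1 ≤ l) {a : k} {c : kˣ}
    (hp : Preserves (oddForm l k) (oddDiag l a c)) :
    HasSpinorNorm (oddForm l k) (oddDiag l a c) (sqClass c) := by
  rcases eq_one_or_eq_neg_one_of_preserves_oddDiag hp with rfl | rfl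
  · exact hasSpinorNorm_oddDiag_one hl c
  · rw [oddDiag_neg_one, ← one_mul (sqClass c)]
    exact (isSplit_oddForm.hasSpinorNorm_one_sub_two_smul_single isMiddle_oddForm).mul
      isSplit_oddForm.isSymm isSplit_oddForm.isUnit_det (hasSpinorNorm_oddDiag_one hl c)

end SplitForms

/-! ### Normal forms under multiplication by matrices of determinant one -/

section NormalForm

variable {k : Type*} [Field k]

section Transvections

variable {ι : Type*} [Fintype ι] [DecidableEq ι]

open Matrix.SpecialLinearGroup

theorem diag2n_eq_prod_transvection {i j : ι} (hij : i ≠ j) {a : k} (ha : a ≠ 0) :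
    diag2n hij a ha =
      transvection hij a * transvection hij.symm (-a⁻¹) * transvection hij a *
        (transvection hij (-1) * transvection hij.symm 1 * transvection hij (-1)) := by
  refine Subtype.ext ?_
  simp only [coe_mul, transvection_coe, diag2n_coe, mul_add, add_mul, one_mul, mul_one,
    single_mul_single_of_ne _ _ _ _ hij, single_mul_single_of_ne _ _ _ _ hij.symm,
    single_mul_single_same, add_zero]
  ext x y
  have h := mul_inv_cancel₀ ha
  simp only [diagonal_apply, Matrix.add_apply, single_apply, one_apply]
  grind

theorem specialLinearGroup_induction_transvection {P : SpecialLinearGroup ι k → Prop} (hone : P 1)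
    (htransvection : ∀ (i j : ι) (hij : i ≠ j) (a : k), P (transvection hij a))
    (hmul : ∀ A B, P A → P B → P (A * B)) (M : SpecialLinearGroup ι k) : P M := by
  rcases subsingleton_or_nontrivial ι with h | h
  · rwa [Subsingleton.elim M 1]
  · refine diagonal_transvection_induction' P M (fun i j hij c hc => ?_) htransvection hmul
    rw [diag2n_eq_prod_transvection]
    exact hmul _ _ (hmul _ _ (hmul _ _ (htransvection ..) (htransvection ..)) (htransvection ..))
      (hmul _ _ (hmul _ _ (htransvection ..) (htransvection ..)) (htransvection ..))

end Transvections

variable {l : ℕ}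

theorem det_diagLam (hl : 1 ≤ l) (c : k) : (diagLam l c).det = c := by
  have hlast : ∀ i : Fin l, (i : ℕ) + 1 = l ↔ i = ⟨l - 1, by lia⟩ := by
    simp only [Fin.ext_iff]; lia
  simp [diagLam, hlast]

theorem diagLam_mul_diagLam_inv (c : kˣ) :
    diagLam l (c : k) * diagLam l ((c⁻¹ : kˣ) : k) = 1 := by
  rw [diagLam, diagLam, diagonal_mul_diagonal, ← diagonal_one]
  congr 1
  ext i
  split_ifs <;> simp

theorem diagLam_entry_ne_zero (c : kˣ) (i : Fin l) :
    (if (i : ℕ) + 1 = l then (c : k) else 1) ≠ 0 := by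
  split_ifs
  exacts [c.ne_zero, one_ne_zero]

theorem diagLam_mul_diagRank {m : ℕ} (hm : m < l) (c : k) :
    diagLam l c * diagRank k l m = diagRank k l m := by
  rw [diagLam, diagRank, diagonal_mul_diagonal]
  congr 1
  ext i
  split_ifs <;> lia

theorem diagRank_mul_diagLam {m : ℕ} (hm : m < l) (c : k) :
    diagRank k l m * diagLam l c = diagRank k l m := by
  rw [diagLam, diagRank, diagonal_mul_diagonal]
  congr 1
  ext i
  split_ifs <;> lia

theorem exists_mul_eq_diagLam (hl : 1 ≤ l) {A : Matrix (Fin l) (Fin l) k} (hA : A.det ≠ 0) :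
    ∃ (P : SpecialLinearGroup (Fin l) k) (c : kˣ), (P : Matrix _ _ k) * A = diagLam l (c : k) := by
  have hu : IsUnit A.det := IsUnit.mk0 _ hA
  refine ⟨⟨diagLam l A.det * A⁻¹, ?_⟩, Units.mk0 _ hA, ?_⟩
  · rw [det_mul, det_diagLam hl, mul_comm, det_nonsing_inv_mul_det _ hu]
  · simp [nonsing_inv_mul_cancel_right _ _ hu]

theorem exists_isUnit_mul_mul_eq_diagRank (A : Matrix (Fin l) (Fin l) k) :
    ∃ V U : Matrix (Fin l) (Fin l) k, IsUnit V ∧ IsUnit U ∧ V * A * U = diagRank k l A.rank := by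
  obtain ⟨V, U, e, hV, hU, hVU⟩ := exists_rank_normal_form A
  have hr : A.rank ≤ l := by simpa using A.rank_le_width
  let e' : Fin A.rank ⊕ Fin (Fintype.card (Fin l) - A.rank) ≃ Fin l :=
    finSumFinEquiv.trans (finCongr (by rw [Fintype.card_fin]; lia))
  let σ : Fin l ≃ Fin l := e'.symm.trans e.symm
  refine ⟨V.submatrix σ id, U.submatrix id σ, (isUnit_submatrix_equiv σ (Equiv.refl _)).mpr hV,
    (isUnit_submatrix_equiv (Equiv.refl _) σ).mpr hU, ?_⟩
  calc V.submatrix σ id * A * U.submatrix id σ = (V * A * U).submatrix σ σ := by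
        rw [← submatrix_mul_equiv (V * A) U σ (Equiv.refl _) σ,
          ← submatrix_mul_equiv V A σ (Equiv.refl _) (Equiv.refl _)]
        rfl
    _ = (diagonal (Sum.elim (fun _ => 1) fun _ => 0)).submatrix e'.symm e'.symm := by
        have hσ : e ∘ σ = e'.symm := by ext i; simp [σ]
        rw [hVU, submatrix_submatrix, hσ, ← diagonal_one, ← diagonal_zero, fromBlocks_diagonal]
    _ = diagRank k l A.rank := by
        rw [submatrix_diagonal_equiv, diagRank]
        congr 1
        ext i
        obtain ⟨j | j, rfl⟩ := e'.surjective i <;> simp [e']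

theorem exists_mul_mul_eq_diagRank {A : Matrix (Fin l) (Fin l) k} (hA : A.det = 0) :
    ∃ P Q : SpecialLinearGroup (Fin l) k, ∃ m < l,
      (P : Matrix _ _ k) * A * (Q : Matrix _ _ k) = diagRank k l m := by
  obtain ⟨V, U, hV, hU, hVU⟩ := exists_isUnit_mul_mul_eq_diagRank A
  have hVd := ((isUnit_iff_isUnit_det V).mp hV).ne_zero
  have hUd := ((isUnit_iff_isUnit_det U).mp hU).ne_zero
  have hm : A.rank < l := by
    refine lt_of_le_of_ne (by simpa using A.rank_le_width) fun h => ?_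
    have hdet : (diagRank k l A.rank).det = 0 := by
      rw [← hVU, det_mul, det_mul, hA, mul_zero, zero_mul]
    simp [diagRank, h] at hdet
  have hl : 1 ≤ l := by lia
  refine ⟨⟨diagLam l V.det⁻¹ * V, ?_⟩, ⟨U * diagLam l U.det⁻¹, ?_⟩, A.rank, hm, ?_⟩
  · rw [det_mul, det_diagLam hl, inv_mul_cancel₀ hVd]
  · rw [det_mul, det_diagLam hl, mul_inv_cancel₀ hUd]
  · calc diagLam l V.det⁻¹ * V * A * (U * diagLam l U.det⁻¹)
        = diagLam l V.det⁻¹ * (V * A * U) * diagLam l U.det⁻¹ := by simp only [Matrix.mul_assoc]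
      _ = diagRank k l A.rank := by rw [hVU, diagLam_mul_diagRank hm, diagRank_mul_diagLam hm]

end NormalForm

/-! ### Row and column operations on the blocks -/

section Operations

namespace Ops

variable {ι k : Type*} [Fintype ι] [Field k] {R C : Set (Matrix ι ι k)}

theorem refl (g : Matrix ι ι k) : Ops R C g g :=
  Relation.ReflTransGen.refl

theorem trans {g h j : Matrix ι ι k} (h₁ : Ops R C g h) (h₂ : Ops R C h j) : Ops R C g j :=
  Relation.ReflTransGen.trans h₁ h₂

theorem row {x : Matrix ι ι k} (hx : x ∈ R) (g : Matrix ι ι k) : Ops R C g (x * g) :=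
  Relation.ReflTransGen.single (Or.inl ⟨x, hx, rfl⟩)

theorem mono {R' C' : Set (Matrix ι ι k)} (hR : R ⊆ R') (hC : C ⊆ C') {g h : Matrix ι ι k}
    (hops : Ops R C g h) : Ops R' C' g h :=
  Relation.ReflTransGen.mono (fun _ _ => Or.imp (fun ⟨x, hx, hxg⟩ => ⟨x, hR hx, hxg⟩)
    fun ⟨x, hx, hxg⟩ => ⟨x, hC hx, hxg⟩) _ _ hops

theorem col {x : Matrix ι ι k} (hx : x ∈ C) (g : Matrix ι ι k) : Ops R C g (g * x) :=
  Relation.ReflTransGen.single (Or.inr ⟨x, hx, rfl⟩)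

end Ops

section Members

variable {ι k : Type*} [DecidableEq ι] [Field k] {l : ℕ} {p n : Fin l → ι}

theorem mem_E1 {i j : Fin l} (hij : i ≠ j) (t : k) :
    1 + t • (single (p i) (p j) 1 - single (n j) (n i) 1) ∈ E1 k p n := ⟨i, j, t, hij, rfl⟩

theorem mem_E3 {i j : Fin l} (hij : i < j) (t : k) :
    1 + t • (single (n i) (p j) 1 - single (n j) (p i) 1) ∈ E3 k p n := ⟨i, j, t, hij, rfl⟩

theorem pos_mem_E4 {z : ι} (i : Fin l) (t : k) :
    1 + t • ((2 : k) • single (p i) z 1 - single z (n i) 1) - t ^ 2 • single (p i) (n i) 1 ∈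
      E4 k z p n := ⟨i, t, Or.inl rfl⟩

theorem neg_mem_E4 {z : ι} (i : Fin l) (t : k) :
    1 + t • (-((2 : k) • single (n i) z 1) + single z (p i) 1) - t ^ 2 • single (n i) (p i) 1 ∈
      E4 k z p n := ⟨i, t, Or.inr rfl⟩

end Members

variable {ι k : Type*} [Fintype ι] [DecidableEq ι] [Field k] {l : ℕ} {p n : Fin l → ι}

theorem single_mul_apply_eq_ite {κ : Type*} (a b c : ι) (d : κ) (x : k) (g : Matrix ι κ k) :
    (single a b x * g) c d = if c = a then x * g b d else 0 := by
  split_ifs with h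
  · rw [h, single_mul_apply_same]
  · rw [single_mul_apply_of_ne _ _ _ _ _ h]

theorem mul_single_apply_eq_ite {κ : Type*} (a b d : ι) (c : κ) (x : k) (g : Matrix κ ι k) :
    (g * single a b x) c d = if d = b then g c a * x else 0 := by
  split_ifs with h
  · rw [h, mul_single_apply_same]
  · rw [mul_single_apply_of_ne _ _ _ _ _ h]

namespace IsSignedIndexing

theorem exists_ops_mul_rows (hs : IsSignedIndexing p n) (C : Set (Matrix ι ι k))
    (P : SpecialLinearGroup (Fin l) k) : ∀ g : Matrix ι ι k, ∃ h, Ops (E1 k p n) C g h ∧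
      h.submatrix p id = P.1 * g.submatrix p id ∧
      h.submatrix n id = (P⁻¹).1ᵀ * g.submatrix n id := by
  induction P using specialLinearGroup_induction_transvection with
  | hone => exact fun g => ⟨g, .refl g, by simp, by simp⟩
  | htransvection i j hij t =>
    refine fun g => ⟨_, .row (mem_E1 hij t) g, ?_, ?_⟩
    · ext a b
      simp [SpecialLinearGroup.transvection_coe, Matrix.add_mul, sub_mul, single_mul_apply_eq_ite,
        hs.injective_pos.eq_iff, hs.pos_ne_neg]
    · ext a b
      simp [SpecialLinearGroup.transvection_inv, SpecialLinearGroup.transvection_coe,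
        Matrix.add_mul, sub_mul, single_mul_apply_eq_ite, hs.injective_neg.eq_iff,
        (hs.pos_ne_neg _ _).symm, neg_ite]
  | hmul A B hA hB =>
    intro g
    obtain ⟨h, hops, hp, hn⟩ := hB g
    obtain ⟨h', hops', hp', hn'⟩ := hA h
    refine ⟨h', hops.trans hops', ?_, ?_⟩
    · rw [hp', hp, ← Matrix.mul_assoc]
      rfl
    · rw [hn', hn, ← Matrix.mul_assoc, ← transpose_mul, _root_.mul_inv_rev]
      rfl

theorem exists_ops_mul_cols (hs : IsSignedIndexing p n) (R : Set (Matrix ι ι k))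
    (P : SpecialLinearGroup (Fin l) k) : ∀ g : Matrix ι ι k, ∃ h, Ops R (E1 k p n) g h ∧
      h.submatrix id p = g.submatrix id p * P.1 := by
  induction P using specialLinearGroup_induction_transvection with
  | hone => exact fun g => ⟨g, .refl g, by simp⟩
  | htransvection i j hij t =>
    refine fun g => ⟨_, .col (mem_E1 hij t) g, ?_⟩
    ext a b
    simp [SpecialLinearGroup.transvection_coe, Matrix.mul_add, mul_sub, mul_single_apply_eq_ite,
      hs.injective_pos.eq_iff, hs.pos_ne_neg, mul_comm t]
  | hmul A B hA hB =>
    intro g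
    obtain ⟨h, hops, hp⟩ := hA g
    obtain ⟨h', hops', hp'⟩ := hB h
    refine ⟨h', hops.trans hops', ?_⟩
    rw [hp', hp, Matrix.mul_assoc]
    rfl

theorem exists_ops_blockA_eq_diagLam (hs : IsSignedIndexing p n) (hl : 1 ≤ l)
    (C : Set (Matrix ι ι k)) {g : Matrix ι ι k} (hg : (blockA p g).det ≠ 0) :
    ∃ (h : Matrix ι ι k) (c : kˣ), Ops (E1 k p n) C g h ∧ blockA p h = diagLam l (c : k) ∧
      (blockC p n g = 0 → blockC p n h = 0) := by
  obtain ⟨P, c, hP⟩ := exists_mul_eq_diagLam hl hg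
  obtain ⟨h, hops, hp, hn⟩ := hs.exists_ops_mul_rows C P g
  have hA : blockA p h = P.1 * blockA p g := congrArg (submatrix · id p) hp
  have hC : blockC p n h = (P⁻¹).1ᵀ * blockC p n g := congrArg (submatrix · id p) hn
  exact ⟨h, c, hops, hA.trans hP, fun h₀ => by rw [hC, h₀, mul_zero]⟩

theorem exists_ops_blockA_eq_diagLam_or_diagRank (hs : IsSignedIndexing p n) (hl : 1 ≤ l)
    (g : Matrix ι ι k) : ∃ h, Ops (E1 k p n) (E1 k p n) g h ∧
      ((∃ c : kˣ, blockA p h = diagLam l (c : k)) ∨ ∃ m < l, blockA p h = diagRank k l m) := by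
  rcases ne_or_eq (blockA p g).det 0 with hg | hg
  · obtain ⟨h, c, hops, hA, -⟩ := hs.exists_ops_blockA_eq_diagLam hl (E1 k p n) hg
    exact ⟨h, hops, .inl ⟨c, hA⟩⟩
  · obtain ⟨P, Q, m, hm, hPQ⟩ := exists_mul_mul_eq_diagRank hg
    obtain ⟨h, hops, hp, -⟩ := hs.exists_ops_mul_rows (E1 k p n) P g
    obtain ⟨h', hops', hp'⟩ := hs.exists_ops_mul_cols (E1 k p n) Q h
    have hA : blockA p h = P.1 * blockA p g := congrArg (submatrix · id p) hp
    have hA' : blockA p h' = blockA p h * Q.1 := congrArg (submatrix · p id) hp'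
    exact ⟨h', hops.trans hops', .inr ⟨m, hm, by rw [hA', hA, hPQ]⟩⟩

theorem exists_ops_add_mul_rows (hs : IsSignedIndexing p n) (C : Set (Matrix ι ι k))
    (U : Matrix (Fin l) (Fin l) k) : ∀ g : Matrix ι ι k, ∃ h, Ops (E3 k p n) C g h ∧
      h.submatrix n id = g.submatrix n id + (U - Uᵀ) * g.submatrix p id ∧
      ∀ a, (∀ i, a ≠ n i) → h a = g a := by
  have hsingle : ∀ i j : Fin l, i < j → ∀ (t : k) (g : Matrix ι ι k), ∃ h, Ops (E3 k p n) C g h ∧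
      h.submatrix n id = g.submatrix n id + (single i j t - single j i t) * g.submatrix p id ∧
      ∀ a, (∀ i, a ≠ n i) → h a = g a := by
    refine fun i j hij t g => ⟨_, .row (mem_E3 hij t) g, ?_, fun a ha => ?_⟩
    · ext a b
      simp [Matrix.add_mul, Matrix.sub_mul, single_mul_apply_eq_ite, hs.injective_neg.eq_iff,
        mul_sub]
    · ext b
      simp [add_mul, sub_mul, ha]
  induction U using Matrix.induction_on' with
  | h_zero => exact fun g => ⟨g, .refl g, by simp, fun _ _ => rfl⟩
  | h_add U V hU hV =>
    intro g
    obtain ⟨h, hops, hn, hrow⟩ := hU g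
    obtain ⟨h', hops', hn', hrow'⟩ := hV h
    have hp : h.submatrix p id = g.submatrix p id :=
      Matrix.ext fun i b => congrFun (hrow (p i) fun j => hs.pos_ne_neg i j) b
    refine ⟨h', hops.trans hops', ?_, fun a ha => (hrow' a ha).trans (hrow a ha)⟩
    rw [hn', hp, hn, add_assoc, ← Matrix.add_mul, transpose_add]
    abel_nf
  | h_std_basis i j t =>
    intro g
    rw [transpose_single]
    rcases lt_trichotomy i j with hij | rfl | hij
    · exact hsingle i j hij t g
    · exact ⟨g, .refl g, by simp, fun _ _ => rfl⟩
    · obtain ⟨h, hops, hn, hrow⟩ := hsingle j i hij (-t) g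
      refine ⟨h, hops, ?_, hrow⟩
      rw [hn, ← single_neg, ← single_neg, neg_sub_neg]

theorem exists_ops_add_vecMul_row (hs : IsSignedIndexing p n) {z : ι} (hzp : ∀ i, z ≠ p i)
    (hzn : ∀ i, z ≠ n i) (C : Set (Matrix ι ι k)) (v : Fin l → k) : ∀ g : Matrix ι ι k, ∃ h,
      Ops (E4 k z p n) C g h ∧ (∀ i, h (p i) = g (p i)) ∧
        h z = g z + v ᵥ* g.submatrix p id := by
  induction v using Pi.single_induction with
  | zero => exact fun g => ⟨g, .refl g, fun _ => rfl, by simp⟩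
  | add u v hu hv =>
    intro g
    obtain ⟨h, hops, hp, hz⟩ := hu g
    obtain ⟨h', hops', hp', hz'⟩ := hv h
    have hsub : h.submatrix p id = g.submatrix p id := Matrix.ext fun i b => congrFun (hp i) b
    refine ⟨h', hops.trans hops', fun i => (hp' i).trans (hp i), ?_⟩
    rw [hz', hz, hsub, add_vecMul, add_assoc]
  | single i t =>
    refine fun g => ⟨_, .row (neg_mem_E4 i t) g, fun j => ?_, ?_⟩
    · ext b
      simp [add_mul, sub_mul, hs.pos_ne_neg, (hzp _).symm]
    · ext b
      simp [add_mul, sub_mul, hzn, single_vecMul]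

theorem exists_ops_add_mulVec_col [NeZero (2 : k)] (hs : IsSignedIndexing p n) {z : ι}
    (hzp : ∀ i, z ≠ p i) (hzn : ∀ i, z ≠ n i) (R : Set (Matrix ι ι k)) (v : Fin l → k) :
    ∀ g : Matrix ι ι k, ∃ h, Ops R (E4 k z p n) g h ∧ (∀ i, h.col (p i) = g.col (p i)) ∧
      h.col z = g.col z + g.submatrix id p *ᵥ v := by
  induction v using Pi.single_induction with
  | zero => exact fun g => ⟨g, .refl g, fun _ => rfl, by simp⟩
  | add u v hu hv =>
    intro g
    obtain ⟨h, hops, hp, hz⟩ := hu g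
    obtain ⟨h', hops', hp', hz'⟩ := hv h
    have hsub : h.submatrix id p = g.submatrix id p := Matrix.ext fun a i => congrFun (hp i) a
    refine ⟨h', hops.trans hops', fun i => (hp' i).trans (hp i), ?_⟩
    rw [hz', hz, hsub, mulVec_add, add_assoc]
  | single i t =>
    refine fun g => ⟨_, .col (pos_mem_E4 i (t / 2)) g, fun j => ?_, ?_⟩
    · ext b
      simp [mul_add, mul_sub, hs.pos_ne_neg, (hzp _).symm]
    · ext b
      have hhalf : ∀ x : k, t / 2 * (x * 2) = t * x := fun x => by
        rw [mul_comm x, ← mul_assoc, div_mul_cancel₀ t two_ne_zero]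
      simp [mul_add, mul_sub, hzn, mulVec_single, hhalf]

theorem exists_ops_clear_row (hs : IsSignedIndexing p n) {z : ι} (hzp : ∀ i, z ≠ p i)
    (hzn : ∀ i, z ≠ n i) (C : Set (Matrix ι ι k)) {g : Matrix ι ι k} {d : Fin l → k}
    (hA : blockA p g = diagonal d) : ∃ h, Ops (E4 k z p n) C g h ∧ (∀ i, h (p i) = g (p i)) ∧
      ∀ i, d i ≠ 0 → h z (p i) = 0 := by
  obtain ⟨h, hops, hp, hz⟩ :=
    hs.exists_ops_add_vecMul_row hzp hzn C (fun i => -(g z (p i) / d i)) g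
  refine ⟨h, hops, hp, fun i hi => ?_⟩
  calc h z (p i) = g z (p i) + ((fun i => -(g z (p i) / d i)) ᵥ* blockA p g) i := congrFun hz (p i)
    _ = 0 := by rw [hA, vecMul_diagonal, neg_mul, div_mul_cancel₀ _ hi, add_neg_cancel]

theorem exists_ops_clear_col [NeZero (2 : k)] (hs : IsSignedIndexing p n) {z : ι}
    (hzp : ∀ i, z ≠ p i) (hzn : ∀ i, z ≠ n i) (R : Set (Matrix ι ι k)) {g : Matrix ι ι k}
    {d : Fin l → k} (hA : blockA p g = diagonal d) : ∃ h, Ops R (E4 k z p n) g h ∧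
      (∀ i, h.col (p i) = g.col (p i)) ∧ ∀ i, d i ≠ 0 → h (p i) z = 0 := by
  obtain ⟨h, hops, hp, hz⟩ :=
    hs.exists_ops_add_mulVec_col hzp hzn R (fun i => -(g (p i) z / d i)) g
  refine ⟨h, hops, hp, fun i hi => ?_⟩
  calc h (p i) z = g (p i) z + (blockA p g *ᵥ fun i => -(g (p i) z / d i)) i := congrFun hz (p i)
    _ = 0 := by rw [hA, mulVec_diagonal, mul_neg, mul_div_cancel₀ _ hi, add_neg_cancel]

theorem exists_ops_clear [NeZero (2 : k)] (hs : IsSignedIndexing p n) {z : ι}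
    (hzp : ∀ i, z ≠ p i) (hzn : ∀ i, z ≠ n i) {g : Matrix ι ι k} {d : Fin l → k}
    (hA : blockA p g = diagonal d) : ∃ h, Ops (E4 k z p n) (E4 k z p n) g h ∧
      blockA p h = diagonal d ∧ ∀ i, d i ≠ 0 → h z (p i) = 0 ∧ h (p i) z = 0 := by
  obtain ⟨h, hops, hp, hzero⟩ := hs.exists_ops_clear_row hzp hzn (E4 k z p n) hA
  have hA' : blockA p h = diagonal d := hA ▸ Matrix.ext fun i j => congrFun (hp i) (p j)
  obtain ⟨h', hops', hp', hzero'⟩ := hs.exists_ops_clear_col hzp hzn (E4 k z p n) hA'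
  exact ⟨h', hops.trans hops', hA' ▸ Matrix.ext fun i j => congrFun (hp' j) (p i),
    fun i hi => ⟨(congrFun (hp' i) z).trans (hzero i hi), hzero' i hi⟩⟩

end IsSignedIndexing

/-- Left multiplication by `w` exchanges the rows with the indices `p i` and `n i`, up to sign, for
the `i` in `s`, and fixes these rows for all other `i`. -/
structure IsInterchange (p n : Fin l → ι) (s : Set (Fin l)) (w : Matrix ι ι k) : Prop where
  pos_of_mem : ∀ (g : Matrix ι ι k), ∀ i ∈ s, (w * g) (p i) = -g (n i)
  neg_of_mem : ∀ (g : Matrix ι ι k), ∀ i ∈ s, (w * g) (n i) = -g (p i)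
  pos_of_notMem : ∀ (g : Matrix ι ι k), ∀ i ∉ s, (w * g) (p i) = g (p i)
  neg_of_notMem : ∀ (g : Matrix ι ι k), ∀ i ∉ s, (w * g) (n i) = g (n i)

theorem IsInterchange.list_prod {f : Fin l → Matrix ι ι k}
    (hf : ∀ i, IsInterchange p n {i} (f i)) {L : List (Fin l)} (hL : L.Nodup) :
    IsInterchange p n {i | i ∈ L} (L.map f).prod := by
  induction L with
  | nil => exact ⟨by simp, by simp, by simp, by simp⟩
  | cons a L ih =>
    obtain ⟨ha, hL⟩ := List.nodup_cons.mp hL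
    obtain ⟨hp, hn, hp', hn'⟩ := ih hL
    simp only [Set.mem_ofPred_eq] at hp hn hp' hn'
    constructor <;> intro g i hi <;>
      simp only [List.map_cons, List.prod_cons, mul_assoc, Set.mem_ofPred_eq, List.mem_cons,
        not_or] at hi ⊢
    · rcases eq_or_ne i a with rfl | hia
      · rw [(hf i).pos_of_mem _ _ rfl, hn' _ _ ha]
      · rw [(hf a).pos_of_notMem _ _ hia, hp _ _ (hi.resolve_left hia)]
    · rcases eq_or_ne i a with rfl | hia
      · rw [(hf i).neg_of_mem _ _ rfl, hp' _ _ ha]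
      · rw [(hf a).neg_of_notMem _ _ hia, hn _ _ (hi.resolve_left hia)]
    · rw [(hf a).pos_of_notMem _ _ hi.1, hp' _ _ hi.2]
    · rw [(hf a).neg_of_notMem _ _ hi.1, hn' _ _ hi.2]

theorem IsInterchange.sub_smul_single {s : Set (Fin l)} {w : Matrix ι ι k}
    (hw : IsInterchange p n s w) {z : ι} (hzp : ∀ i, z ≠ p i) (hzn : ∀ i, z ≠ n i) (c : k) :
    IsInterchange p n s (w - c • single z z 1) := by
  have hsub : ∀ (g : Matrix ι ι k) (a : ι), z ≠ a →
      ((w - c • single z z 1) * g : Matrix ι ι k) a = (w * g) a := by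
    intro g a ha
    ext b
    simp [sub_mul, ha.symm]
  constructor <;> intro g i hi
  · rw [hsub g _ (hzp i), hw.pos_of_mem g i hi]
  · rw [hsub g _ (hzn i), hw.neg_of_mem g i hi]
  · rw [hsub g _ (hzp i), hw.pos_of_notMem g i hi]
  · rw [hsub g _ (hzn i), hw.neg_of_notMem g i hi]

theorem IsSignedIndexing.isInterchange_wMat (hs : IsSignedIndexing p n) (i : Fin l) :
    IsInterchange p n {i} (wMat k p n i) := by
  constructor <;> intro g j hj <;> ext b <;>
    simp_all [wMat, sub_mul, hs.pos_ne_neg, (hs.pos_ne_neg _ _).symm, hs.injective_pos.eq_iff,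
      hs.injective_neg.eq_iff]

end Operations

/-! ### The shape of an isometry with vanishing block `C` -/

section Relations

variable {ι k : Type*} [Fintype ι] [Field k] {l : ℕ}

/-- `ζ` is the coordinate along the part of the space that is orthogonal to the hyperbolic planes
with the indices `p i`, `n i`. It is zero in even dimension. -/
def HasCoords (β : Matrix ι ι k) (p n : Fin l → ι) (ζ : (ι → k) → k) : Prop :=
  ∀ u v, bil β u v = 2 * ζ u * ζ v + ∑ i, (u (p i) * v (n i) + u (n i) * v (p i))

omit [Fintype ι] [Field k] in
theorem IsSignedIndexing.blockA_eq_of_rows_eq {p n : Fin l → ι}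
    (hs : IsSignedIndexing p n) {g h : Matrix ι ι k} (hrow : ∀ a, (∀ i, a ≠ n i) → h a = g a) :
    blockA p h = blockA p g :=
  Matrix.ext fun i j => congrFun (hrow (p i) fun a => hs.pos_ne_neg i a) (p j)

namespace HasCoords

variable {β g : Matrix ι ι k} {p n : Fin l → ι} {ζ : (ι → k) → k}

theorem swap (hc : HasCoords β p n ζ) : HasCoords β n p ζ := by
  intro u v
  rw [hc]
  simp only [add_comm]

theorem apply_eq (hc : HasCoords β p n ζ) (hg : Preserves β g) (a b : ι) :
    2 * ζ (g.col a) * ζ (g.col b) + ∑ i, (g (p i) a * g (n i) b + g (n i) a * g (p i) b) =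
      β a b := by
  classical
  have h := preserves_iff_bil.mp hg (Pi.single a 1) (Pi.single b 1)
  rw [hc] at h
  simpa [bil] using h

variable [DecidableEq ι]

variable [NeZero (2 : k)] (hc : HasCoords β p n ζ) (hs : IsSplit β p n) (hg : Preserves β g)
include hc hs hg

omit [NeZero (2 : k)] in
theorem blockC_relation {d : Fin l → k} (hA : blockA p g = diagonal d) (i j : Fin l) :
    2 * ζ (g.col (p i)) * ζ (g.col (p j)) + (d i * blockC p n g i j + d j * blockC p n g j i) =
      0 := by
  have hA' : ∀ a b, g (p a) (p b) = if a = b then d a else 0 := fun a b =>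
    (congrFun₂ hA a b).trans (diagonal_apply ..)
  have h := hc.apply_eq hg (p i) (p j)
  rw [show β (p i) (p j) = 0 from (congrFun (hs.col_pos j) (p i)).trans
    (Pi.single_eq_of_ne (hs.pos_ne_neg i j) 1)] at h
  simpa [hA', Finset.sum_add_distrib, mul_comm (g _ _), blockC] using h

theorem coord_eq_zero_of_blockC_eq_zero (hC : blockC p n g = 0) (i : Fin l) :
    ζ (g.col (p i)) = 0 := by
  have hC' : ∀ a b, g (n a) (p b) = 0 := congrFun₂ hC
  have h := hc.apply_eq hg (p i) (p i)
  rw [show β (p i) (p i) = 0 from (congrFun (hs.col_pos i) (p i)).trans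
    (Pi.single_eq_of_ne (hs.pos_ne_neg i i) 1)] at h
  simpa [hC', two_ne_zero] using h

theorem transpose_blockA_mul_rows (hC : blockC p n g = 0) :
    (blockA p g)ᵀ * g.submatrix n id = (1 : Matrix ι ι k).submatrix n id := by
  have hC' : ∀ a b, g (n a) (p b) = 0 := congrFun₂ hC
  ext i b
  have h := hc.apply_eq hg (p i) b
  rw [← hs.isSymm.apply, show β b (p i) = _ from congrFun (hs.col_pos i) b,
    hc.coord_eq_zero_of_blockC_eq_zero hs hg hC] at h
  simpa [hC', Matrix.mul_apply, blockA, one_apply, Pi.single_apply, eq_comm] using h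

theorem det_blockA_ne_zero (hC : blockC p n g = 0) : (blockA p g).det ≠ 0 := by
  have h : (blockA p g)ᵀ * blockA n g = 1 :=
    (congrArg (submatrix · id n) (hc.transpose_blockA_mul_rows hs hg hC)).trans
      (submatrix_one n hs.injective_neg)
  have hdet := congrArg det h
  rw [det_mul, det_transpose, det_one] at hdet
  exact left_ne_zero_of_mul_eq_one hdet

theorem neg_row_eq {c : kˣ} (hA : blockA p g = diagLam l (c : k)) (hC : blockC p n g = 0)
    (i : Fin l) : g (n i) = diagLam l ((c⁻¹ : kˣ) : k) i i • Pi.single (n i) 1 := by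
  have h : g.submatrix n id =
      diagLam l ((c⁻¹ : kˣ) : k) * (1 : Matrix ι ι k).submatrix n id := by
    rw [← hc.transpose_blockA_mul_rows hs hg hC, hA, ← Matrix.mul_assoc,
      show (diagLam l (c : k))ᵀ = diagLam l (c : k) from diagonal_transpose _,
      mul_eq_one_comm.mp (diagLam_mul_diagLam_inv c), Matrix.one_mul]
  ext b
  refine (congrFun₂ h i b).trans ?_
  simp [diagLam, one_apply, Pi.single_apply, eq_comm]

theorem exists_ops_clear_blockC {d : Fin l → k} (hA : blockA p g = diagonal d)
    (hX : ∀ i, d i ≠ 0 → ζ (g.col (p i)) = 0) :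
    ∃ h, Ops (E3 k p n) ∅ g h ∧ (∀ a, (∀ i, a ≠ n i) → h a = g a) ∧
      ∀ i j, d i ≠ 0 → d j ≠ 0 → blockC p n h i j = 0 := by
  let U : Matrix (Fin l) (Fin l) k := of fun i j => -(blockC p n g i j / d j) / 2
  obtain ⟨h, hops, hrows, hrow⟩ := hs.exists_ops_add_mul_rows ∅ U g
  refine ⟨h, hops, hrow, fun i j hi hj => ?_⟩
  have hC : blockC p n h = blockC p n g + (U - Uᵀ) * diagonal d := by
    rw [← hA]
    exact congrArg (submatrix · id p) hrows
  -- The relation says that `C A⁻¹` is skew where it is defined, so that `U - Uᵀ = -C A⁻¹` there.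
  have hskew := hc.blockC_relation hs hg hA i j
  rw [hX i hi, mul_zero, zero_mul, zero_add] at hskew
  rw [hC, Matrix.add_apply, mul_diagonal, Matrix.sub_apply, transpose_apply]
  simp only [U, of_apply]
  have h2 := two_ne_zero (α := k)
  field_simp
  linear_combination hskew

theorem exists_ops_blockC_eq_zero {c : kˣ} (hA : blockA p g = diagLam l (c : k))
    (hX : ∀ i, ζ (g.col (p i)) = 0) :
    ∃ h, Ops (E3 k p n) ∅ g h ∧ (∀ a, (∀ i, a ≠ n i) → h a = g a) ∧ blockC p n h = 0 := by
  obtain ⟨h, hops, hrow, hzero⟩ := hc.exists_ops_clear_blockC hs hg hA fun i _ => hX i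
  exact ⟨h, hops, hrow, Matrix.ext fun i j =>
    hzero i j (diagLam_entry_ne_zero c i) (diagLam_entry_ne_zero c j)⟩

theorem blockC_interchange_eq_zero {m : ℕ} (hA : blockA p g = diagRank k l m)
    (hX : ∀ i : Fin l, (i : ℕ) < m → ζ (g.col (p i)) = 0)
    (hC : ∀ i j : Fin l, (i : ℕ) < m → (j : ℕ) < m → blockC p n g i j = 0)
    {w : Matrix ι ι k} (hw : IsInterchange p n {i | m ≤ (i : ℕ)} w) :
    blockC p n (w * g) = 0 := by
  have hrel := hc.blockC_relation hs hg hA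
  have hX' : ∀ i, ζ (g.col (p i)) = 0 := fun i => by
    rcases lt_or_ge (i : ℕ) m with hi | hi
    · exact hX i hi
    · simpa [hi.not_gt, two_ne_zero] using hrel i i
  ext i j
  rcases lt_or_ge (i : ℕ) m with hi | hi
  · refine (congrFun (hw.neg_of_notMem g i hi.not_ge) (p j)).trans ?_
    rcases lt_or_ge (j : ℕ) m with hj | hj
    · exact hC i j hi hj
    · simpa [hX', hi, hj.not_gt, blockC] using hrel i j
  · refine (congrFun (hw.neg_of_mem g i hi) (p j)).trans (neg_eq_zero.mpr ?_)
    refine (congrFun₂ hA i j).trans ?_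
    simp [diagRank, diagonal_apply, hi.not_gt]

end HasCoords

theorem hasCoords_evenForm : HasCoords (evenForm l k) ep en fun _ => 0 := by
  intro u v
  simp [bil, evenForm, dotProduct, Fintype.sum_sum_type, mulVec, one_apply, ep, en,
    Finset.sum_add_distrib]

theorem hasCoords_oddForm : HasCoords (oddForm l k) op on fun u => u oz := by
  intro u v
  simp only [bil, oddForm, dotProduct, Fintype.sum_sum_type, mulVec]
  simp [one_apply, op, on, oz, Finset.sum_add_distrib, mul_assoc, mul_left_comm]

variable [DecidableEq ι] [NeZero (2 : k)] {β : Matrix ι ι k} {p n : Fin l → ι}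

theorem IsSplit.preserves_of_ops (hs : IsSplit β p n) {g h : Matrix ι ι k}
    (hops : Ops (spinorKernel β) (spinorKernel β) g h) (hg : Preserves β g) : Preserves β h := by
  obtain ⟨y, rfl⟩ := hg.exists_toMat_eq hs.isUnit_det
  exact (HasSpinorNorm.of_ops hs.isSymm hs.isUnit_det hops ⟨y, rfl, rfl⟩).preserves

theorem IsSplit.spinorNorm_eq_and_mem_commutator_iff (hs : IsSplit β p n) (hl : 1 ≤ l)
    {g : orthGroup β} {h : Matrix ι ι k} {c : kˣ}
    (hops : Ops (spinorKernel β) (spinorKernel β) (toMat g) h)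
    (hh : HasSpinorNorm β h (sqClass c)) :
    spinorNorm β g = sqClass c ∧
      ((toMat g).det = 1 → (g ∈ commutator (orthGroup β) ↔ IsSquare (c : k))) := by
  have hnorm : spinorNorm β g = sqClass c :=
    (HasSpinorNorm.of_ops hs.isSymm hs.isUnit_det hops ⟨g, rfl, rfl⟩).unique hh
  refine ⟨hnorm, fun hdet => ?_⟩
  rw [(hs.isHyperbolicPair ⟨0, hl⟩).mem_commutator_iff hs.isSymm hs.isUnit_det hdet, hnorm,
    sqClass_eq_one, isSquare_coe_units]

end Relations

/-! ### The algorithm in even dimension -/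

section EvenAlgorithm

variable {k : Type*} [Field k] {l : ℕ}

theorem isInterchange_evenSwap (m : ℕ) :
    IsInterchange ep en {i : Fin l | m ≤ (i : ℕ)} (evenSwap k l m) := by
  have hs := isSplit_evenForm (k := k) (l := l)
  simpa [evenSwap] using IsInterchange.list_prod hs.isInterchange_wMat
    ((List.nodup_finRange l).filter fun i : Fin l => decide (m ≤ (i : ℕ)))

variable [NeZero (2 : k)]

theorem evenSwap_mem_spinorKernel (m : ℕ) : evenSwap k l m ∈ spinorKernel (evenForm l k) := by
  refine HasSpinorNorm.list_prod isSplit_evenForm.isSymm isSplit_evenForm.isUnit_det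
    (List.forall_mem_map.mpr fun i _ => ?_)
  exact isSplit_evenForm.hasSpinorNorm_wMat i

theorem evenElem_subset_spinorKernel : EvenElem l k ⊆ spinorKernel (evenForm l k) := by
  have hs := isSplit_evenForm (k := k) (l := l)
  refine Set.union_subset (Set.union_subset (Set.union_subset hs.E1_subset_spinorKernel
    hs.E2_subset_spinorKernel) hs.E3_subset_spinorKernel) ?_
  rintro _ ⟨i, -, rfl⟩
  exact hs.hasSpinorNorm_wMat i

variable {g h : Matrix (EvenIdx l) (EvenIdx l) k} {c : kˣ}

theorem EvenStep1.ops (hstep : EvenStep1 g h) :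
    Ops (spinorKernel (evenForm l k)) (spinorKernel (evenForm l k)) g h :=
  hstep.1.mono isSplit_evenForm.E1_subset_spinorKernel isSplit_evenForm.E1_subset_spinorKernel

theorem EvenStep2.ops (hstep : EvenStep2 g h) :
    Ops (spinorKernel (evenForm l k)) (spinorKernel (evenForm l k)) g h := by
  have hE1 := (isSplit_evenForm (k := k) (l := l)).E1_subset_spinorKernel
  have hE3 := (isSplit_evenForm (k := k) (l := l)).E3_subset_spinorKernel
  rcases hstep.1 with ⟨-, hops⟩ | ⟨m, -, -, h, hops, -, hops'⟩
  · exact hops.mono hE3 (Set.empty_subset _)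
  · exact ((hops.mono hE3 (Set.empty_subset _)).trans
      (.row (evenSwap_mem_spinorKernel m) h)).trans (hops'.mono hE1 hE1)

theorem EvenStep3.ops (hstep : EvenStep3 g c) :
    Ops (spinorKernel (evenForm l k)) (spinorKernel (evenForm l k)) g (evenDiag l c) :=
  Ops.mono isSplit_evenForm.E2_subset_spinorKernel (Set.empty_subset _) hstep

theorem EvenOutputs.ops (hout : EvenOutputs g c) :
    Ops (spinorKernel (evenForm l k)) (spinorKernel (evenForm l k)) g (evenDiag l c) := by
  obtain ⟨g₁, g₂, h₁, h₂, h₃⟩ := hout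
  exact (h₁.ops.trans h₂.ops).trans h₃.ops

theorem EvenReduces.ops (hred : EvenReduces g c) :
    Ops (spinorKernel (evenForm l k)) (spinorKernel (evenForm l k)) g (evenDiag l c) :=
  Ops.mono evenElem_subset_spinorKernel evenElem_subset_spinorKernel hred

theorem exists_eq_fromBlocks_diagLam (hg : Preserves (evenForm l k) g)
    (hA : blockA ep g = diagLam l (c : k)) (hC : blockC ep en g = 0) :
    ∃ B, g = fromBlocks (diagLam l (c : k)) B 0 (diagLam l ((c⁻¹ : kˣ) : k)) := by
  have hrow := hasCoords_evenForm.neg_row_eq isSplit_evenForm hg hA hC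
  refine ⟨g.toBlocks₁₂, ?_⟩
  conv_lhs => rw [← fromBlocks_toBlocks g]
  congr 1
  ext i j
  refine (congrFun (hrow i) (en j)).trans ?_
  simp [diagLam, diagonal_apply, en, Pi.single_apply, eq_comm]

theorem exists_evenStep2_of_diagLam (hg : Preserves (evenForm l k) g)
    (hA : blockA ep g = diagLam l (c : k)) : ∃ h, EvenStep2 g h := by
  have hs := isSplit_evenForm (k := k) (l := l)
  obtain ⟨h, hops, hrow, hC⟩ :=
    hasCoords_evenForm.exists_ops_blockC_eq_zero hs hg hA fun _ => rfl
  have hh := hs.preserves_of_ops (hops.mono hs.E3_subset_spinorKernel (Set.empty_subset _)) hg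
  have hAh := (hs.blockA_eq_of_rows_eq hrow).trans hA
  exact ⟨h, .inl ⟨⟨c, hA⟩, hops⟩, c, exists_eq_fromBlocks_diagLam hh hAh hC⟩

theorem exists_evenStep2_of_diagRank (hl : 1 ≤ l) (hg : Preserves (evenForm l k) g) {m : ℕ}
    (hm : m < l) (hA : blockA ep g = diagRank k l m) : ∃ h, EvenStep2 g h := by
  have hs := isSplit_evenForm (k := k) (l := l)
  obtain ⟨h, hops, hrow, hC⟩ :=
    hasCoords_evenForm.exists_ops_clear_blockC hs hg hA fun _ _ => rfl
  have hC' : ∀ i j : Fin l, (i : ℕ) < m → (j : ℕ) < m → blockC ep en h i j = 0 :=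
    fun i j hi hj => hC i j (by simp [hi]) (by simp [hj])
  have hh := hs.preserves_of_ops (hops.mono hs.E3_subset_spinorKernel (Set.empty_subset _)) hg
  have hAh := (hs.blockA_eq_of_rows_eq hrow).trans hA
  have hw : Preserves (evenForm l k) (evenSwap k l m * h) :=
    (evenSwap_mem_spinorKernel m).preserves.mul hh
  have hCw := hasCoords_evenForm.blockC_interchange_eq_zero hs hh hAh (fun _ _ => rfl) hC'
    (isInterchange_evenSwap m)
  obtain ⟨g', c, hops', hA', hC₀⟩ := hs.exists_ops_blockA_eq_diagLam hl (E1 k ep en)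
    (hasCoords_evenForm.det_blockA_ne_zero hs hw hCw)
  have hg' := hs.preserves_of_ops
    (hops'.mono hs.E1_subset_spinorKernel hs.E1_subset_spinorKernel) hw
  exact ⟨g', .inr ⟨m, hm, hA, h, hops, hC', hops'⟩, c,
    exists_eq_fromBlocks_diagLam hg' hA' (hC₀ hCw)⟩

theorem evenStep3_fromBlocks {B : Matrix (Fin l) (Fin l) k}
    (hg : Preserves (evenForm l k)
      (fromBlocks (diagLam l (c : k)) B 0 (diagLam l ((c⁻¹ : kˣ) : k)))) :
    EvenStep3 (fromBlocks (diagLam l (c : k)) B 0 (diagLam l ((c⁻¹ : kˣ) : k))) c := by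
  have hs := (isSplit_evenForm (k := k) (l := l)).swap
  obtain ⟨h, hops, hrow, hB⟩ :=
    hasCoords_evenForm.swap.exists_ops_blockC_eq_zero hs hg (c := c⁻¹) rfl fun _ => rfl
  have hh := hs.preserves_of_ops (hops.mono hs.E3_subset_spinorKernel (Set.empty_subset _)) hg
  have hpos := hasCoords_evenForm.swap.neg_row_eq hs hh (hs.blockA_eq_of_rows_eq hrow) hB
  have heq : h = evenDiag l c := by
    ext (i | i) b
    · refine (congrFun (hpos i) b).trans ?_
      rcases b with b | b <;>
        simp [evenDiag, diagLam, diagonal_apply, ep, Pi.single_apply, eq_comm]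
    · exact congrFun (hrow (Sum.inr i) fun _ => Sum.inr_ne_inl) b
  rw [EvenStep3, ← heq]
  exact hops

theorem exists_evenOutputs (hl : 1 ≤ l) (hg : Preserves (evenForm l k) g) :
    ∃ c : kˣ, EvenOutputs g c := by
  have hs := isSplit_evenForm (k := k) (l := l)
  obtain ⟨g₁, h₁⟩ : ∃ g₁, EvenStep1 g g₁ := hs.exists_ops_blockA_eq_diagLam_or_diagRank hl g
  have hg₁ := hs.preserves_of_ops h₁.ops hg
  obtain ⟨g₂, h₂⟩ : ∃ g₂, EvenStep2 g₁ g₂ := by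
    rcases h₁.2 with ⟨c, hA⟩ | ⟨m, hm, hA⟩
    exacts [exists_evenStep2_of_diagLam hg₁ hA, exists_evenStep2_of_diagRank hl hg₁ hm hA]
  have hg₂ := hs.preserves_of_ops h₂.ops hg₁
  obtain ⟨-, c, B, rfl⟩ := id h₂
  exact ⟨c, g₁, _, h₁, h₂, evenStep3_fromBlocks hg₂⟩

end EvenAlgorithm

/-! ### The algorithm in odd dimension -/

section OddAlgorithm

variable {k : Type*} [Field k] {l : ℕ}

theorem XEZero.of_rows_eq {m : ℕ} {g h : Matrix (OddIdx l) (OddIdx l) k} (hg : XEZero m g)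
    (hrow : ∀ a, (∀ i, a ≠ on i) → h a = g a) : XEZero m h := by
  intro i hi
  rw [hrow oz (by simp [oz, on]), hrow (op i) (by simp [op, on])]
  exact hg i hi

variable [NeZero (2 : k)]

theorem isInterchange_oddSwap (m : ℕ) :
    IsInterchange op on {i : Fin l | m ≤ (i : ℕ)} (oddSwap k l m) := by
  have hs := isSplit_oddForm (k := k) (l := l)
  have hz := isMiddle_oddForm (k := k) (l := l)
  simpa [oddSwap] using IsInterchange.list_prod
    (fun i => (hs.isInterchange_wMat i).sub_smul_single hz.ne_pos hz.ne_neg (2 : k))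
    ((List.nodup_finRange l).filter fun i : Fin l => decide (m ≤ (i : ℕ)))

theorem hasSpinorNorm_wMat_sub (i : Fin l) :
    HasSpinorNorm (oddForm l k) (wMat k op on i - (2 : k) • single oz oz 1) 1 := by
  have hs := isSplit_oddForm (k := k) (l := l)
  have hfix : wMat k op on i oz = Pi.single (oz : OddIdx l) 1 := by
    ext b
    simp [wMat, oz, op, on, one_apply, Pi.single_apply, eq_comm]
  have hmul : wMat k op on i - (2 : k) • single oz oz 1 =
      (1 - (2 : k) • single oz oz 1) * wMat k op on i := by
    rw [sub_mul, one_mul, smul_mul_assoc]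
    congr 2
    ext a b
    rw [single_mul_apply_eq_ite, hfix]
    simp [single_apply, Pi.single_apply, eq_comm, ite_and]
  rw [hmul]
  simpa using (hs.hasSpinorNorm_one_sub_two_smul_single isMiddle_oddForm).mul hs.isSymm
    hs.isUnit_det (hs.hasSpinorNorm_wMat i)

theorem oddSwap_mem_spinorKernel (m : ℕ) : oddSwap k l m ∈ spinorKernel (oddForm l k) :=
  HasSpinorNorm.list_prod isSplit_oddForm.isSymm isSplit_oddForm.isUnit_det
    (List.forall_mem_map.mpr fun i _ => hasSpinorNorm_wMat_sub i)

theorem oddElem_subset_spinorKernel : OddElem l k ⊆ spinorKernel (oddForm l k) := by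
  have hs := isSplit_oddForm (k := k) (l := l)
  refine Set.union_subset (Set.union_subset (Set.union_subset (Set.union_subset
    hs.E1_subset_spinorKernel hs.E2_subset_spinorKernel) hs.E3_subset_spinorKernel)
    (hs.E4_subset_spinorKernel isMiddle_oddForm)) ?_
  rintro _ ⟨i, -, rfl⟩
  exact hs.hasSpinorNorm_wMat i

variable {g h : Matrix (OddIdx l) (OddIdx l) k} {c : kˣ}

theorem OddStep1.ops (hstep : OddStep1 g h) :
    Ops (spinorKernel (oddForm l k)) (spinorKernel (oddForm l k)) g h :=
  hstep.1.mono isSplit_oddForm.E1_subset_spinorKernel isSplit_oddForm.E1_subset_spinorKernel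

theorem OddStep2.ops (hstep : OddStep2 g h) :
    Ops (spinorKernel (oddForm l k)) (spinorKernel (oddForm l k)) g h :=
  hstep.1.mono (isSplit_oddForm.E4_subset_spinorKernel isMiddle_oddForm)
    (isSplit_oddForm.E4_subset_spinorKernel isMiddle_oddForm)

theorem OddStep3.ops (hstep : OddStep3 g h) :
    Ops (spinorKernel (oddForm l k)) (spinorKernel (oddForm l k)) g h :=
  hstep.1.mono isSplit_oddForm.E3_subset_spinorKernel (Set.empty_subset _)

theorem OddStep4.ops (hstep : OddStep4 g h) :
    Ops (spinorKernel (oddForm l k)) (spinorKernel (oddForm l k)) g h := by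
  have hE1 := (isSplit_oddForm (k := k) (l := l)).E1_subset_spinorKernel
  have hE4 := (isSplit_oddForm (k := k) (l := l)).E4_subset_spinorKernel isMiddle_oddForm
  rcases hstep.1 with ⟨-, rfl⟩ | ⟨m, -, h', hops, hops'⟩
  · exact .refl _
  · exact ((Ops.row (oddSwap_mem_spinorKernel m) g).trans (hops.mono hE1 hE1)).trans
      (hops'.mono hE4 hE4)

theorem OddStep5.ops (hstep : OddStep5 g c) :
    ∃ a, Ops (spinorKernel (oddForm l k)) (spinorKernel (oddForm l k)) g (oddDiag l a c) := by
  obtain ⟨a, hops⟩ := hstep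
  exact ⟨a, hops.mono isSplit_oddForm.E2_subset_spinorKernel (Set.empty_subset _)⟩

theorem OddOutputs.ops (hout : OddOutputs g c) :
    ∃ a, Ops (spinorKernel (oddForm l k)) (spinorKernel (oddForm l k)) g (oddDiag l a c) := by
  obtain ⟨g₁, g₂, g₃, g₄, h₁, h₂, h₃, h₄, h₅⟩ := hout
  obtain ⟨a, hops⟩ := h₅.ops
  exact ⟨a, (((h₁.ops.trans h₂.ops).trans h₃.ops).trans h₄.ops).trans hops⟩

theorem OddReduces.ops (hred : OddReduces g c) :
    ∃ a, Ops (spinorKernel (oddForm l k)) (spinorKernel (oddForm l k)) g (oddDiag l a c) := by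
  obtain ⟨a, hops⟩ := hred
  exact ⟨a, hops.mono oddElem_subset_spinorKernel oddElem_subset_spinorKernel⟩

theorem middle_row_eq (hg : Preserves (oddForm l k) g)
    (hE : ∀ i, g (op i) oz = 0) (hX : ∀ i, g oz (op i) = 0)
    (hneg : ∀ i, g (on i) oz = 0) : g oz = Pi.single (oz : OddIdx l) (g oz oz) := by
  have hrel := hasCoords_oddForm.apply_eq hg oz
  simp only [hE, hneg, zero_mul, add_zero, Finset.sum_const_zero, col_apply] at hrel
  have h₀ : g oz oz ≠ 0 := by
    intro h₀
    have := hrel oz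
    rw [h₀, mul_zero] at this
    exact two_ne_zero (α := k) (by simpa [oddForm, oz] using this.symm)
  have hY : ∀ i, g oz (on i) = 0 := by
    intro i
    refine (mul_eq_zero.mp ((hrel (on i)).trans ?_)).resolve_left (mul_ne_zero two_ne_zero h₀)
    simp [oddForm, oz, on]
  ext (b | b | b)
  · simp [oz]
  · exact (hX b).trans (by simp [oz])
  · exact (hY b).trans (by simp [oz])

theorem exists_eq_oddBlock (hg : Preserves (oddForm l k) g)
    (hA : blockA op g = diagLam l (c : k)) (hC : blockC op on g = 0)
    (hE : ∀ i, g (op i) oz = 0) :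
    ∃ a B, g = oddBlock a (diagLam l (c : k)) B (diagLam l ((c⁻¹ : kˣ) : k)) := by
  have hs := isSplit_oddForm (k := k) (l := l)
  have hc := hasCoords_oddForm (k := k) (l := l)
  have hneg := hc.neg_row_eq hs hg hA hC
  have hmid := middle_row_eq hg hE (hc.coord_eq_zero_of_blockC_eq_zero hs hg hC)
    fun i => (congrFun (hneg i) oz).trans (by simp [oz, on])
  refine ⟨g oz oz, of fun i j => g (op i) (on j), ?_⟩
  ext (a | a | a) b
  · refine (congrFun hmid b).trans ?_
    rcases b with b | b | b <;> simp [oddBlock, oz]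
  · rcases b with _ | b | _
    exacts [hE a, congrFun (congrFun hA a) b, rfl]
  · refine (congrFun (hneg a) b).trans ?_
    rcases b with b | b | b <;>
      simp [oddBlock, diagLam, diagonal_apply, on, Pi.single_apply, eq_comm]

theorem exists_oddStep2 (hform : (∃ c : kˣ, blockA op g = diagLam l (c : k)) ∨
    ∃ m < l, blockA op g = diagRank k l m) : ∃ h, OddStep2 g h := by
  have hs := isSplit_oddForm (k := k) (l := l)
  have hz := isMiddle_oddForm (k := k) (l := l)
  rcases hform with ⟨c, hA⟩ | ⟨m, hm, hA⟩
  · obtain ⟨h, hops, hA', hXE⟩ := hs.exists_ops_clear hz.ne_pos hz.ne_neg hA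
    exact ⟨h, hops, .inl ⟨⟨c, hA'⟩, fun i _ => hXE i (diagLam_entry_ne_zero c i)⟩⟩
  · obtain ⟨h, hops, hA', hXE⟩ := hs.exists_ops_clear hz.ne_pos hz.ne_neg hA
    exact ⟨h, hops, .inr ⟨m, hm, hA', fun i hi => hXE i (by simp [hi])⟩⟩

theorem exists_oddStep3 (hg : Preserves (oddForm l k) g)
    (hform : OddFull g ∨ ∃ m, OddPartial m g) : ∃ h, OddStep3 g h := by
  have hs := isSplit_oddForm (k := k) (l := l)
  have hc := hasCoords_oddForm (k := k) (l := l)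
  rcases hform with ⟨⟨c, hA⟩, hXE⟩ | ⟨m, hm, hA, hXE⟩
  · obtain ⟨h, hops, hrow, hC⟩ := hc.exists_ops_blockC_eq_zero hs hg hA fun i => (hXE i i.2).1
    exact ⟨h, hops, .inl ⟨⟨⟨c, (hs.blockA_eq_of_rows_eq hrow).trans hA⟩, hXE.of_rows_eq hrow⟩, hC⟩⟩
  · obtain ⟨h, hops, hrow, hC⟩ := hc.exists_ops_clear_blockC hs hg hA fun i hi =>
      (hXE i (by simpa using hi)).1
    exact ⟨h, hops, .inr ⟨m, ⟨hm, (hs.blockA_eq_of_rows_eq hrow).trans hA, hXE.of_rows_eq hrow⟩,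
      fun i j hi hj => hC i j (by simp [hi]) (by simp [hj])⟩⟩

theorem exists_oddStep4_of_full (hg : Preserves (oddForm l k) g) (hfull : OddFull g)
    (hC : blockC op on g = 0) : ∃ h, OddStep4 g h := by
  obtain ⟨c, hA⟩ := hfull.1
  obtain ⟨a, B, heq⟩ := exists_eq_oddBlock hg hA hC fun i => (hfull.2 i i.2).2
  exact ⟨g, .inl ⟨hfull, rfl⟩, a, c, B, heq⟩

theorem exists_oddStep4_of_partial (hl : 1 ≤ l) (hg : Preserves (oddForm l k) g) {m : ℕ}
    (hpart : OddPartial m g)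
    (hC : ∀ i j : Fin l, (i : ℕ) < m → (j : ℕ) < m → blockC op on g i j = 0) :
    ∃ h, OddStep4 g h := by
  have hs := isSplit_oddForm (k := k) (l := l)
  have hc := hasCoords_oddForm (k := k) (l := l)
  have hz := isMiddle_oddForm (k := k) (l := l)
  have hE4 := hs.E4_subset_spinorKernel hz
  have hw : Preserves (oddForm l k) (oddSwap k l m * g) :=
    (oddSwap_mem_spinorKernel m).preserves.mul hg
  have hCw := hc.blockC_interchange_eq_zero hs hg hpart.2.1 (fun i hi => (hpart.2.2 i hi).1) hC
    (isInterchange_oddSwap m)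
  obtain ⟨g', c, hops, hA, hC'⟩ := hs.exists_ops_blockA_eq_diagLam hl (E1 k op on)
    (hc.det_blockA_ne_zero hs hw hCw)
  have hg' := hs.preserves_of_ops (hops.mono hs.E1_subset_spinorKernel hs.E1_subset_spinorKernel) hw
  obtain ⟨h, hops', hcol, hE⟩ := hs.exists_ops_clear_col hz.ne_pos hz.ne_neg (E4 k oz op on) hA
  obtain ⟨a, B, heq⟩ := exists_eq_oddBlock (hs.preserves_of_ops (hops'.mono hE4 hE4) hg')
    ((Matrix.ext fun i j => congrFun (hcol j) (op i)).trans hA)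
    ((Matrix.ext fun i j => congrFun (hcol j) (on i)).trans (hC' hCw))
    fun i => hE i (diagLam_entry_ne_zero c i)
  exact ⟨h, .inr ⟨m, hpart, g', hops, hops'⟩, a, c, B, heq⟩

theorem oddStep5_oddBlock {a : k} {B : Matrix (Fin l) (Fin l) k}
    (hg : Preserves (oddForm l k)
      (oddBlock a (diagLam l (c : k)) B (diagLam l ((c⁻¹ : kˣ) : k)))) :
    OddStep5 (oddBlock a (diagLam l (c : k)) B (diagLam l ((c⁻¹ : kˣ) : k))) c := by
  have hs := (isSplit_oddForm (k := k) (l := l)).swap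
  obtain ⟨h, hops, hrow, hB⟩ :=
    hasCoords_oddForm.swap.exists_ops_blockC_eq_zero hs hg (c := c⁻¹) rfl fun _ => rfl
  have hh := hs.preserves_of_ops (hops.mono hs.E3_subset_spinorKernel (Set.empty_subset _)) hg
  have hpos := hasCoords_oddForm.swap.neg_row_eq hs hh (hs.blockA_eq_of_rows_eq hrow) hB
  have heq : h = oddDiag l a c := by
    ext (i | i | i) b
    · exact congrFun (hrow (Sum.inl i) fun _ => Sum.inl_ne_inr) b
    · refine (congrFun (hpos i) b).trans ?_
      rcases b with b | b | b <;>
        simp [oddDiag, oddBlock, diagLam, diagonal_apply, op, Pi.single_apply, eq_comm]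
    · exact congrFun (hrow (Sum.inr (Sum.inr i)) (by simp [op])) b
  exact ⟨a, heq ▸ hops⟩

theorem exists_oddOutputs (hl : 1 ≤ l) (hg : Preserves (oddForm l k) g) :
    ∃ c : kˣ, OddOutputs g c := by
  have hs := isSplit_oddForm (k := k) (l := l)
  obtain ⟨g₁, h₁⟩ : ∃ g₁, OddStep1 g g₁ := hs.exists_ops_blockA_eq_diagLam_or_diagRank hl g
  have hg₁ := hs.preserves_of_ops h₁.ops hg
  obtain ⟨g₂, h₂⟩ := exists_oddStep2 h₁.2
  have hg₂ := hs.preserves_of_ops h₂.ops hg₁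
  obtain ⟨g₃, h₃⟩ := exists_oddStep3 hg₂ h₂.2
  have hg₃ := hs.preserves_of_ops h₃.ops hg₂
  obtain ⟨g₄, h₄⟩ : ∃ g₄, OddStep4 g₃ g₄ := by
    rcases h₃.2 with ⟨hfull, hC⟩ | ⟨m, hpart, hC⟩
    exacts [exists_oddStep4_of_full hg₃ hfull hC, exists_oddStep4_of_partial hl hg₃ hpart hC]
  have hg₄ := hs.preserves_of_ops h₄.ops hg₃
  obtain ⟨-, a, c, B, rfl⟩ := id h₄
  exact ⟨c, g₁, g₂, g₃, _, h₁, h₂, h₃, h₄, oddStep5_oddBlock hg₄⟩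

end OddAlgorithm

end

end SplitOrth

open SplitOrth

theorem corollaryA1 {k : Type*} [Field k] (hk : ringChar k ≠ 2) (l : ℕ) (hl : 1 ≤ l) :
    -- even dimension `2l`
    (∀ g : SplitOrth.orthGroup (SplitOrth.evenForm l k),
      -- the spinor norm is well defined
      ((∃ us, SplitOrth.IsProdOfReflections (SplitOrth.evenForm l k) g us) ∧
        ∀ us, SplitOrth.IsProdOfReflections (SplitOrth.evenForm l k) g us →
          ∀ a : kˣ, (a : k) = (us.map fun u => SplitOrth.bil (SplitOrth.evenForm l k) u u / 2).prod →
            SplitOrth.spinorNorm (SplitOrth.evenForm l k) g = SplitOrth.sqClass a) ∧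
      -- the algorithm can be carried out on `g`
      (∃ lam : kˣ, SplitOrth.EvenOutputs (SplitOrth.toMat g) lam) ∧
      -- every entry that it produces represents the spinor norm
      (∀ lam : kˣ, SplitOrth.EvenOutputs (SplitOrth.toMat g) lam ∨
          SplitOrth.EvenReduces (SplitOrth.toMat g) lam →
        SplitOrth.spinorNorm (SplitOrth.evenForm l k) g = SplitOrth.sqClass lam ∧
        ((SplitOrth.toMat g).det = 1 →
          (g ∈ commutator (SplitOrth.orthGroup (SplitOrth.evenForm l k)) ↔
            IsSquare (lam : k))))) ∧
    -- odd dimension `2l + 1`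
    (∀ g : SplitOrth.orthGroup (SplitOrth.oddForm l k),
      ((∃ us, SplitOrth.IsProdOfReflections (SplitOrth.oddForm l k) g us) ∧
        ∀ us, SplitOrth.IsProdOfReflections (SplitOrth.oddForm l k) g us →
          ∀ a : kˣ, (a : k) = (us.map fun u => SplitOrth.bil (SplitOrth.oddForm l k) u u / 2).prod →
            SplitOrth.spinorNorm (SplitOrth.oddForm l k) g = SplitOrth.sqClass a) ∧
      (∃ lam : kˣ, SplitOrth.OddOutputs (SplitOrth.toMat g) lam) ∧
      (∀ lam : kˣ, SplitOrth.OddOutputs (SplitOrth.toMat g) lam ∨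
          SplitOrth.OddReduces (SplitOrth.toMat g) lam →
        SplitOrth.spinorNorm (SplitOrth.oddForm l k) g = SplitOrth.sqClass lam ∧
        ((SplitOrth.toMat g).det = 1 →
          (g ∈ commutator (SplitOrth.orthGroup (SplitOrth.oddForm l k)) ↔
            IsSquare (lam : k))))) := by
  have : NeZero (2 : k) := ⟨Ring.two_ne_zero hk⟩
  refine ⟨fun g => ?_, fun g => ?_⟩
  · have hs := isSplit_evenForm (k := k) (l := l)
    refine ⟨⟨exists_isProdOfReflections hs.isSymm hs.isUnit_det g,
      fun us hus a ha => spinorNorm_eq hs.isSymm hs.isUnit_det hus ha⟩,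
      exists_evenOutputs hl (preserves_toMat g), fun c hc => ?_⟩
    exact hs.spinorNorm_eq_and_mem_commutator_iff hl
      (hc.elim EvenOutputs.ops EvenReduces.ops) (hasSpinorNorm_evenDiag hl c)
  · have hs := isSplit_oddForm (k := k) (l := l)
    refine ⟨⟨exists_isProdOfReflections hs.isSymm hs.isUnit_det g,
      fun us hus a ha => spinorNorm_eq hs.isSymm hs.isUnit_det hus ha⟩,
      exists_oddOutputs hl (preserves_toMat g), fun c hc => ?_⟩
    obtain ⟨a, hops⟩ := hc.elim OddOutputs.ops OddReduces.ops
    exact hs.spinorNorm_eq_and_mem_commutator_iff hl hops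
      (hasSpinorNorm_oddDiag hl (hs.preserves_of_ops hops (preserves_toMat g)))
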